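/- Let $\mathbb G$ be a group of Heisenberg type: a simply connected stratified nilpotent Lie group of step two with Lie algebra $\mathfrak g=\mathfrak h\oplus\mathfrak v$, where $[\mathfrak h,\mathfrak h]=\mathfrak v\neq\{0\}$ and $[\mathfrak g,\mathfrak v]=\{0\}$, carrying an inner product with $\mathfrak h\perp\mathfrak v$ for which the maps $J(\sigma)\in\operatorname{End}(\mathfrak h)$, $\langle J(\sigma)z,z'\rangle=\langle[z,z'],\sigma\rangle$, are orthogonal whenever $|\sigma|=1$. Write $m=\dim\mathfrak h$, $k=\dim\mathfrak v$, $Q=m+2k$, and $x=(z,\sigma)$ for the logarithmic coordinates with respect to orthonormal bases $e_1,\dots,e_m$ of $\mathfrak h$ and $\varepsilon_1,\dots,\varepsilon_k$ of $\mathfrak v$; $dx$ is Lebesgue measure in these coordinates. Let $X_i$, $T_\ell$ be the left-invariant vector fields with values $e_i$, $\varepsilon_\ell$ at the identity, $\nabla_H f=\sum_i X_if\,X_i$ the horizontal gradient, and $\nabla f=\sum_iX_if\,X_i+\sum_\ell T_\ell f\,T_\ell$ the Riemannian gradient for the left-invariant metric in which $X_1,\dots,X_m,T_1,\dots,T_k$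 are orthonormal. Let $1<p<\infty$ and let $\mathring W^{1,p}_H(\Omega)$ be the closure of $C_c^\infty(\Omega)$ in the norm $\|u\|_{L^p(\Omega)}+\|\nabla_Hu\|_{L^p(\Omega)}$. **Theorem 1.2.** Let $\Omega\subset\mathbb G$ be a nonempty, connected, bounded open set with smooth boundary, and let $f\in\mathring W^{1,p}_H(\Omega)$ be a weak solution of $$\Delta_{H,p}f=\sum_{i=1}^mX_i\big(|\nabla_Hf|^{p-2}X_if\big)=-|z|^p\ \text{ in }\Omega,\qquad f=0\ \text{ on }\partial\Omega,$$ that is, $\int_\Omega|\nabla_Hf|^{p-2}\langle\nabla_Hf,\nabla_H\varphi\rangle\,dx=\int_\Omega|z|^p\varphi\,dx$ for every $\varphi\in\mathring W^{1,p}_H(\Omega)$. Suppose that for some $c\ge0$ one has $|\nabla_Hf|=c\,|z|$ and $f=0$ on $\partial\Omega$ in the following sense: for every $\varepsilon>0$ there is an open set $O\supset\partial\Omega$ such that $\big||\nabla_Hf(x)|-c\,|z|\big|<\varepsilon$ and $|f(x)|<\varepsilon$ for a.e. $x=(z,\sigma)\in\Omega\cap O$. Suppose moreover that $f\in\Gamma^{2,\alpha}(\overline\Omega)$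 for some $\alpha\in(0,1)$, i.e. $f$, $X_if$ and $X_iX_jf$ $(1\le i,j\le m)$ exist and are bounded in $\Omega$ and Hölder continuous of exponent $\alpha$ there with respect to the distance $d(x,y)=N(x^{-1}\circ y)$, $N(z,\sigma)=(|z|^4+16|\sigma|^2)^{1/4}$, and that $\nabla f$ (continued from $\Omega$ to $\partial\Omega$) does not vanish at any point of $\partial\Omega$. Then $c>0$, and the function $$P(x)=|\nabla_Hf(x)|^p+\frac{2p}{(p-1)(Q+p)}\,f(x)\,|z|^p$$ is integrable on $\Omega$ and satisfies $$\int_\Omega P(x)\,dx=c^p\int_\Omega|z|^p\,dx.$$ -/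

import Mathlib

open MeasureTheory Filter Topology
open scoped ContDiff

noncomputable section

namespace HType

/-- Points in logarithmic coordinates `x = (z, σ)` with respect to fixed orthonormal bases
of the horizontal layer (dimension `m`) and of the centre (dimension `k`). The Lie algebra
`𝔥 ⊕ 𝔳` has the same underlying space. The measure `volume` on it is Lebesgue
measure in these coordinates, a bi-invariant Haar measure of the group. -/
abbrev Pt (m k : ℕ) : Type := EuclideanSpace ℝ (Fin m) × EuclideanSpace ℝ (Fin k)

/-- The Kaplan map: `⟨J(σ) z, z'⟩ = ⟨[z, z'], σ⟩`, see `inner_kaplanJ`. -/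
def kaplanJ {m k : ℕ}
    (B : EuclideanSpace ℝ (Fin m) →ₗ[ℝ] EuclideanSpace ℝ (Fin m) →ₗ[ℝ] EuclideanSpace ℝ (Fin k))
    (σ : EuclideanSpace ℝ (Fin k)) (z : EuclideanSpace ℝ (Fin m)) : EuclideanSpace ℝ (Fin m) :=
  LinearMap.adjoint (B z) σ

theorem inner_kaplanJ {m k : ℕ}
    (B : EuclideanSpace ℝ (Fin m) →ₗ[ℝ] EuclideanSpace ℝ (Fin m) →ₗ[ℝ] EuclideanSpace ℝ (Fin k))
    (σ : EuclideanSpace ℝ (Fin k)) (z z' : EuclideanSpace ℝ (Fin m)) :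
    inner ℝ (kaplanJ B σ z) z' = inner ℝ (B z z') σ := by
  unfold kaplanJ
  rw [LinearMap.adjoint_inner_left, real_inner_comm]

/-- A Lie algebra of Heisenberg type, in orthonormal coordinates: a stratified nilpotent Lie
algebra `𝔥 ⊕ 𝔳` of step two (`dim 𝔥 = m`, `dim 𝔳 = k`), determined by the bracket
`𝔥 × 𝔥 → 𝔳` (all other brackets vanish), such that `J(σ)` is orthogonal for `|σ| = 1`.
It determines the simply connected group up to isomorphism. -/
structure HeisenbergType (m k : ℕ) where
  bracket : EuclideanSpace ℝ (Fin m) →ₗ[ℝ] EuclideanSpace ℝ (Fin m) →ₗ[ℝ]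
    EuclideanSpace ℝ (Fin k)
  bracket_self : ∀ z, bracket z z = 0
  /-- `[𝔥, 𝔥] = 𝔳` -/
  bracket_span : Submodule.span ℝ {w | ∃ z z', bracket z z' = w} = ⊤
  /-- the step is two: `𝔳 ≠ 0` -/
  center_pos : 0 < k
  J_orthogonal : ∀ σ : EuclideanSpace ℝ (Fin k), ‖σ‖ = 1 → ∀ z z',
    inner ℝ (kaplanJ bracket σ z) (kaplanJ bracket σ z') = inner ℝ z z'

variable {m k : ℕ}

/-- The group law (Baker-Campbell-Hausdorff):
`(z, σ) ∘ (z', σ') = (z + z', σ + σ' + [z, z'] / 2)`. -/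
def mul (H : HeisenbergType m k) (x y : Pt m k) : Pt m k :=
  (x.1 + y.1, x.2 + y.2 + (1 / 2 : ℝ) • H.bracket x.1 y.1)

/-- The Korányi gauge `N(z, σ) = (|z|⁴ + 16 |σ|²)^{1/4}`. -/
def gauge (x : Pt m k) : ℝ := (‖x.1‖ ^ 4 + 16 * ‖x.2‖ ^ 2) ^ (1 / 4 : ℝ)

/-- The gauge distance `d(x, y) = N(x⁻¹ ∘ y)`; in logarithmic coordinates `x⁻¹ = -x`. -/
def gaugeDist (H : HeisenbergType m k) (x y : Pt m k) : ℝ := gauge (mul H (-x) y)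

/-- The homogeneous dimension `Q = m + 2k`. -/
def homDim (m k : ℕ) : ℝ := (m : ℝ) + 2 * (k : ℝ)

/-- The integral curve `t ↦ x ∘ exp(t v)` through `x` of the left-invariant vector field with
value `v` at the identity. -/
def curve (H : HeisenbergType m k) (v x : Pt m k) (t : ℝ) : Pt m k := mul H x (t • v)

/-- The derivative of `f` along the left-invariant vector field with value `v` at the identity. -/
def lieDeriv (H : HeisenbergType m k) (v : Pt m k) (f : Pt m k → ℝ) (x : Pt m k) : ℝ :=
  deriv (fun t : ℝ => f (curve H v x t)) 0

/-- The `i`-th basis vector `e_i` of the horizontal layer. -/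
def hBasis (m k : ℕ) (i : Fin m) : Pt m k := (EuclideanSpace.single i (1 : ℝ), 0)

/-- The `l`-th basis vector `ε_l` of the centre. -/
def vBasis (m k : ℕ) (l : Fin k) : Pt m k := (0, EuclideanSpace.single l (1 : ℝ))

/-- `X_i f`. -/
def X (H : HeisenbergType m k) (i : Fin m) (f : Pt m k → ℝ) : Pt m k → ℝ :=
  lieDeriv H (hBasis m k i) f

/-- `T_l f`. -/
def T (H : HeisenbergType m k) (l : Fin k) (f : Pt m k → ℝ) : Pt m k → ℝ :=
  lieDeriv H (vBasis m k l) f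

/-- The horizontal gradient, in the orthonormal frame `X_1, …, X_m`. -/
def hgrad (H : HeisenbergType m k) (f : Pt m k → ℝ) (x : Pt m k) : EuclideanSpace ℝ (Fin m) :=
  WithLp.toLp 2 fun i => X H i f x

/-- The Riemannian gradient, in the orthonormal frame `X_1, …, X_m, T_1, …, T_k`. -/
def rgrad (H : HeisenbergType m k) (f : Pt m k → ℝ) (x : Pt m k) : Pt m k :=
  (hgrad H f x, WithLp.toLp 2 fun l => T H l f x)

/-- A smooth bounded domain: nonempty, open, connected, bounded, and near each boundary point
it is the sublevel set of a smooth function with nonvanishing differential. -/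
structure IsSmoothDomain (Ω : Set (Pt m k)) : Prop where
  isOpen : IsOpen Ω
  isConnected : IsConnected Ω
  isBounded : Bornology.IsBounded Ω
  smooth_boundary : ∀ x₀ ∈ frontier Ω, ∃ (U : Set (Pt m k)) (ρ : Pt m k → ℝ),
    IsOpen U ∧ x₀ ∈ U ∧ ContDiffOn ℝ ∞ ρ U ∧ fderiv ℝ ρ x₀ ≠ 0 ∧ Ω ∩ U = {x ∈ U | ρ x < 0}

/-- `C_c^∞(Ω)`. -/
def IsTest (Ω : Set (Pt m k)) (φ : Pt m k → ℝ) : Prop :=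
  ContDiff ℝ ∞ φ ∧ HasCompactSupport φ ∧ tsupport φ ⊆ Ω

/-- `u` belongs to the closure of `C_c^∞(Ω)` in the horizontal Sobolev space of exponent `p`,
and `U` is its weak horizontal gradient: `u` and `U` are the limits in `L^p(Ω)` of `φ_n` and
of the horizontal gradients of `φ_n`, for some test functions `φ_n`. -/
def MemW0 (H : HeisenbergType m k) (p : ℝ) (Ω : Set (Pt m k)) (u : Pt m k → ℝ)
    (U : Pt m k → EuclideanSpace ℝ (Fin m)) : Prop :=
  MemLp u (ENNReal.ofReal p) (volume.restrict Ω) ∧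
  MemLp U (ENNReal.ofReal p) (volume.restrict Ω) ∧
  ∃ φ : ℕ → Pt m k → ℝ, (∀ n, IsTest Ω (φ n)) ∧
    Tendsto (fun n => eLpNorm (fun x => φ n x - u x) (ENNReal.ofReal p) (volume.restrict Ω))
      atTop (𝓝 0) ∧
    Tendsto (fun n => eLpNorm (fun x => hgrad H (φ n) x - U x) (ENNReal.ofReal p)
      (volume.restrict Ω)) atTop (𝓝 0)

/-- Weak solution, in the closure of `C_c^∞(Ω)`, of the Dirichlet problem
`Δ_{H,p} f = -|z|^p` in `Ω`, `f = 0` on `∂Ω`. For `p < 2` the vector `|F|^{p-2} F` is read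
as `0` where `F = 0`. -/
def IsWeakSolution (H : HeisenbergType m k) (p : ℝ) (Ω : Set (Pt m k)) (f : Pt m k → ℝ) : Prop :=
  ∃ F : Pt m k → EuclideanSpace ℝ (Fin m), MemW0 H p Ω f F ∧
    ∀ (φ : Pt m k → ℝ) (Φ : Pt m k → EuclideanSpace ℝ (Fin m)), MemW0 H p Ω φ Φ →
      ∫ x in Ω, ‖F x‖ ^ (p - 2) * inner ℝ (F x) (Φ x) = ∫ x in Ω, ‖x.1‖ ^ p * φ x

/-- The boundary conditions `|∇_H f| = c |z|` and `f = 0` on `∂Ω`, in the measure theoretic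
sense. -/
def BoundaryConditions (H : HeisenbergType m k) (Ω : Set (Pt m k)) (f : Pt m k → ℝ) (c : ℝ) :
    Prop :=
  ∀ ε > 0, ∃ O : Set (Pt m k), IsOpen O ∧ frontier Ω ⊆ O ∧
    ∀ᵐ x ∂(volume : Measure (Pt m k)), x ∈ Ω ∩ O →
      |‖hgrad H f x‖ - c * ‖x.1‖| < ε ∧ |f x| < ε

/-- `Γ^{0,α}`: bounded and Hölder continuous of exponent `α` for the gauge distance on `Ω`;
such functions extend uniquely to the closure of `Ω`, with the same bounds. -/
def IsGamma0 (H : HeisenbergType m k) (α : ℝ) (Ω : Set (Pt m k)) (u : Pt m k → ℝ) : Prop :=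
  ∃ M : ℝ, (∀ x ∈ Ω, |u x| ≤ M) ∧ ∀ x ∈ Ω, ∀ y ∈ Ω, |u x - u y| ≤ M * gaugeDist H x y ^ α

/-- The Folland-Stein class `Γ^{2,α}` on the closure of the open set `Ω`: the horizontal
derivatives of order at most two exist in `Ω` and, like `f`, belong to `Γ^{0,α}` up to the
boundary. -/
structure IsGamma2 (H : HeisenbergType m k) (α : ℝ) (Ω : Set (Pt m k)) (f : Pt m k → ℝ) :
    Prop where
  diff_one : ∀ i, ∀ x ∈ Ω, DifferentiableAt ℝ (fun t : ℝ => f (curve H (hBasis m k i) x t)) 0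
  diff_two : ∀ i j, ∀ x ∈ Ω,
    DifferentiableAt ℝ (fun t : ℝ => X H j f (curve H (hBasis m k i) x t)) 0
  holder_zero : IsGamma0 H α Ω f
  holder_one : ∀ i, IsGamma0 H α Ω (X H i f)
  holder_two : ∀ i j, IsGamma0 H α Ω (X H i (X H j f))

/-- The Riemannian gradient of `f`, continued from `Ω` to `∂Ω`, vanishes nowhere on `∂Ω`. -/
def RGradNonvanishingOnBoundary (H : HeisenbergType m k) (Ω : Set (Pt m k))
    (f : Pt m k → ℝ) : Prop :=
  ∀ x₀ ∈ frontier Ω, ∃ g : Pt m k, g ≠ 0 ∧ Tendsto (rgrad H f) (𝓝[Ω] x₀) (𝓝 g)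

/-- `P = |∇_H f|^p + (2p / ((p-1)(Q+p))) f |z|^p`. -/
def P (H : HeisenbergType m k) (p : ℝ) (f : Pt m k → ℝ) (x : Pt m k) : ℝ :=
  ‖hgrad H f x‖ ^ p + 2 * p / ((p - 1) * (homDim m k + p)) * (f x * ‖x.1‖ ^ p)

end HType

end

/-! The identity is a Pohozaev identity for the dilations `(r z, r² σ)`, with generator `Z = euler`,
of homogeneous dimension `Q`. Write `E = ∫ |∇_H f|^p`. Testing the equation with `f` gives `E = ∫
|z|^p f`, so `∫ P` is an explicit multiple of `E`. Formally, testing with `Z f` gives a second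
relation, between `E` and the boundary term `(1 - 1/p) ∫_{∂Ω} |∇_H f|^p ⟨Z, ν⟩`. On the boundary
`|∇_H f|^p = c^p |z|^p`, and since `|z|^p Z` has divergence `(Q + p) |z|^p`, the boundary term
equals `(1 - 1/p) (Q + p) c^p ∫ |z|^p`. Eliminating `E` gives the claim. If `c` were zero, then `E =
0` and `∇_H f = 0` a.e., against the equation.

Two points need care. The field `Z` contains central derivatives, so `Z f` makes sense only after
showing that `f` is Euclidean `C¹` in `Ω`. Central derivatives are commutators of horizontal ones,
hence exist and are continuous because the second horizontal derivatives do
(`HasFrameDeriv.bracket`, `IsGamma2.contDiffOn`). Moreover `Z f` is only continuous, so it is not an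
admissible test function. In `dilation_identity` it is replaced by the difference `f ∘ dil r - f`
times a cutoff; convexity of `|·|^p` shows that a differentiable function of `r` is minimal at `r =
1`, and its vanishing derivative is the identity.

No surface integrals are used. The cutoffs `θ` are functions of `f` near the boundary, so `dθ = d ·
df` with `d ≥ 0`, and `d Z f dx` plays the role of boundary measure (`IsLevelCutoff.pohozaev`). This
needs `f > 0` near the boundary, which follows from `f ≥ 0` (`nonneg_of_isWeakC1Solution`) and the
nonvanishing of the Riemannian gradient (`exists_compact_pos`). The same nonvanishing bounds `∫ d |Z
f|` uniformly (`exists_uniform_bound`), so in the limit `|∇_H f|^p` may be replaced by `c^p |z|^p`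
in the boundary terms. -/

noncomputable section

namespace HType

variable {m k : ℕ}

/-! ### Left-invariant fields, their integral curves and the horizontal gradient -/

/-- The left-invariant vector field with value `v` at the identity. -/
def frameVec (H : HeisenbergType m k) (v x : Pt m k) : Pt m k :=
  (v.1, v.2 + (1 / 2 : ℝ) • H.bracket x.1 v.1)

theorem bracket_swap (H : HeisenbergType m k) (z w : EuclideanSpace ℝ (Fin m)) :
    H.bracket z w = -H.bracket w z := by
  have h := H.bracket_self (z + w)
  simp only [map_add, LinearMap.add_apply, H.bracket_self, zero_add, add_zero] at h
  rw [eq_neg_iff_add_eq_zero]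
  simpa [add_comm] using h

/-- In step two with logarithmic coordinates the integral curves are straight lines, traversed with
the constant velocity `frameVec H v x`. -/
theorem curve_eq (H : HeisenbergType m k) (v x : Pt m k) (t : ℝ) :
    curve H v x t = x + t • frameVec H v x := by
  ext1 <;> simp [curve, mul, frameVec, smul_add, smul_smul, add_assoc, mul_comm]

theorem frameVec_curve (H : HeisenbergType m k) (v x : Pt m k) (t : ℝ) :
    frameVec H v (curve H v x t) = frameVec H v x := by
  ext1 <;> simp [curve, mul, frameVec, H.bracket_self]

theorem curve_curve (H : HeisenbergType m k) (v x : Pt m k) (s t : ℝ) :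
    curve H v (curve H v x s) t = curve H v x (s + t) := by
  rw [curve_eq H v (curve H v x s), frameVec_curve, curve_eq, curve_eq, add_smul, add_assoc]

@[simp] theorem curve_zero (H : HeisenbergType m k) (v x : Pt m k) : curve H v x 0 = x := by
  simp [curve_eq]

theorem curve_smul (H : HeisenbergType m k) (r : ℝ) (v x : Pt m k) (t : ℝ) :
    curve H (r • v) x t = curve H v x (r * t) := by
  simp [curve, smul_smul, mul_comm]

theorem continuous_bracket (H : HeisenbergType m k) :
    Continuous fun q : EuclideanSpace ℝ (Fin m) × EuclideanSpace ℝ (Fin m) =>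
      H.bracket q.1 q.2 := by
  let C : EuclideanSpace ℝ (Fin m) →L[ℝ] EuclideanSpace ℝ (Fin m) →L[ℝ]
      EuclideanSpace ℝ (Fin k) :=
    LinearMap.toContinuousLinearMap
      ((LinearMap.toContinuousLinearMap :
        (EuclideanSpace ℝ (Fin m) →ₗ[ℝ] EuclideanSpace ℝ (Fin k)) ≃ₗ[ℝ] _).toLinearMap ∘ₗ
          H.bracket)
  exact (C.continuous.comp continuous_fst).clm_apply continuous_snd

theorem continuous_mul (H : HeisenbergType m k) :
    Continuous fun q : Pt m k × Pt m k => mul H q.1 q.2 := by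
  unfold mul
  have h := (continuous_bracket H).comp
    ((continuous_fst.comp (continuous_fst (X := Pt m k) (Y := Pt m k))).prodMk
      (continuous_fst.comp continuous_snd))
  simp only [Function.comp_def] at h
  fun_prop

theorem continuous_curve (H : HeisenbergType m k) (v : Pt m k) :
    Continuous fun q : Pt m k × ℝ => curve H v q.1 q.2 := by
  have := (continuous_mul H).comp
    ((continuous_fst (X := Pt m k) (Y := ℝ)).prodMk (continuous_snd.smul (continuous_const (y := v))))
  exact this

theorem contDiff_frameVec (H : HeisenbergType m k) (v : Pt m k) :
    ContDiff ℝ ∞ (frameVec H v) := by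
  have h : ContDiff ℝ ∞ (H.bracket.flip v.1) :=
    (LinearMap.toContinuousLinearMap (H.bracket.flip v.1)).contDiff
  have h' := h.comp (contDiff_fst (E := EuclideanSpace ℝ (Fin m)) (F := EuclideanSpace ℝ (Fin k)))
  simp only [Function.comp_def, LinearMap.flip_apply] at h'
  unfold frameVec
  fun_prop

theorem hasDerivAt_curve (H : HeisenbergType m k) (v x : Pt m k) (t : ℝ) :
    HasDerivAt (curve H v x) (frameVec H v x) t := by
  have : curve H v x = fun t => x + t • frameVec H v x := funext (curve_eq H v x)
  rw [this]
  simpa using ((hasDerivAt_id t).smul_const (frameVec H v x)).const_add x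

theorem lieDeriv_eq_fderiv (H : HeisenbergType m k) (v : Pt m k) {f : Pt m k → ℝ} {x : Pt m k}
    (hf : DifferentiableAt ℝ f x) : lieDeriv H v f x = fderiv ℝ f x (frameVec H v x) := by
  have h : HasFDerivAt f (fderiv ℝ f x) (curve H v x 0) := by simpa using hf.hasFDerivAt
  exact (h.comp_hasDerivAt (0 : ℝ) (hasDerivAt_curve H v x 0)).deriv

theorem frameVec_add (H : HeisenbergType m k) (v w x : Pt m k) :
    frameVec H (v + w) x = frameVec H v x + frameVec H w x := by
  ext1
  · simp [frameVec]
  · simp only [frameVec, Prod.snd_add, Prod.fst_add, map_add, smul_add]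
    abel

theorem frameVec_smul (H : HeisenbergType m k) (r : ℝ) (v x : Pt m k) :
    frameVec H (r • v) x = r • frameVec H v x := by
  ext1
  · simp [frameVec]
  · simp [frameVec, smul_smul, mul_comm]

theorem frameVec_sum (H : HeisenbergType m k) {ι : Type*} (s : Finset ι) (v : ι → Pt m k)
    (x : Pt m k) : frameVec H (∑ i ∈ s, v i) x = ∑ i ∈ s, frameVec H (v i) x := by
  let L : Pt m k →ₗ[ℝ] Pt m k :=
    { toFun := fun v => frameVec H v x
      map_add' := fun v w => frameVec_add H v w x
      map_smul' := fun r v => frameVec_smul H r v x }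
  exact map_sum L v s

theorem sum_hBasis_add_sum_vBasis (v : Pt m k) :
    v = ∑ i, v.1 i • hBasis m k i + ∑ l, v.2 l • vBasis m k l := by
  ext1
  · ext i
    simp [hBasis, vBasis, Prod.fst_sum, Pi.single_apply]
  · ext i
    simp [hBasis, vBasis, Prod.snd_sum, Pi.single_apply]

theorem fderiv_frameVec_eq_inner (H : HeisenbergType m k) {f : Pt m k → ℝ} {x : Pt m k}
    (hf : DifferentiableAt ℝ f x) (v : Pt m k) :
    fderiv ℝ f x (frameVec H v x) =
      inner ℝ (rgrad H f x).1 v.1 + inner ℝ (rgrad H f x).2 v.2 := by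
  conv_lhs => rw [sum_hBasis_add_sum_vBasis v]
  rw [frameVec_add, frameVec_sum, frameVec_sum, map_add, map_sum, map_sum]
  simp only [frameVec_smul, map_smul, rgrad, hgrad, X, T, PiLp.inner_apply,
    lieDeriv_eq_fderiv H _ hf, smul_eq_mul, RCLike.inner_apply, conj_trivial]

/-- The horizontal part of a covector `L` at the point `x`. -/
def horiz (H : HeisenbergType m k) (x : Pt m k) (L : Pt m k →L[ℝ] ℝ) :
    EuclideanSpace ℝ (Fin m) :=
  WithLp.toLp 2 fun i => L (frameVec H (hBasis m k i) x)

theorem hgrad_eq_horiz (H : HeisenbergType m k) {f : Pt m k → ℝ} {x : Pt m k}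
    (hf : DifferentiableAt ℝ f x) : hgrad H f x = horiz H x (fderiv ℝ f x) := by
  simp only [hgrad, horiz, X, lieDeriv_eq_fderiv H _ hf]

theorem horiz_add (H : HeisenbergType m k) (x : Pt m k) (L L' : Pt m k →L[ℝ] ℝ) :
    horiz H x (L + L') = horiz H x L + horiz H x L' := by
  ext i; simp [horiz]

theorem horiz_sub (H : HeisenbergType m k) (x : Pt m k) (L L' : Pt m k →L[ℝ] ℝ) :
    horiz H x (L - L') = horiz H x L - horiz H x L' := by
  ext i; simp [horiz]

theorem horiz_smul (H : HeisenbergType m k) (x : Pt m k) (r : ℝ) (L : Pt m k →L[ℝ] ℝ) :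
    horiz H x (r • L) = r • horiz H x L := by
  ext i; simp [horiz]

@[simp] theorem horiz_zero (H : HeisenbergType m k) (x : Pt m k) : horiz H x 0 = 0 := by
  ext i; simp [horiz]

theorem continuous_horiz (H : HeisenbergType m k) :
    Continuous fun q : Pt m k × (Pt m k →L[ℝ] ℝ) => horiz H q.1 q.2 := by
  unfold horiz
  refine (PiLp.continuous_toLp 2 _).comp (continuous_pi fun i => ?_)
  exact continuous_snd.clm_apply ((contDiff_frameVec H _).continuous.comp continuous_fst)

theorem continuous_hgrad (H : HeisenbergType m k) {f : Pt m k → ℝ} (hf : ContDiff ℝ 1 f) :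
    Continuous (hgrad H f) := by
  have : hgrad H f = fun x => horiz H x (fderiv ℝ f x) :=
    funext fun x => hgrad_eq_horiz H (hf.differentiable one_ne_zero x)
  rw [this]
  exact (continuous_horiz H).comp (continuous_id.prodMk (hf.continuous_fderiv one_ne_zero))

theorem continuousOn_hgrad (H : HeisenbergType m k) {f : Pt m k → ℝ} {Ω : Set (Pt m k)}
    (hΩ : IsOpen Ω) (hf : ContDiffOn ℝ 1 f Ω) : ContinuousOn (hgrad H f) Ω := by
  have : ContinuousOn (fun x => horiz H x (fderiv ℝ f x)) Ω :=
    (continuous_horiz H).comp_continuousOn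
      (continuousOn_id.prodMk (hf.continuousOn_fderiv_of_isOpen hΩ le_rfl))
  refine this.congr fun x hx => hgrad_eq_horiz H ?_
  exact (hf.differentiableOn one_ne_zero).differentiableAt (hΩ.mem_nhds hx)

theorem hgrad_congr (H : HeisenbergType m k) {f g : Pt m k → ℝ} {x : Pt m k}
    (h : f =ᶠ[𝓝 x] g) : hgrad H f x = hgrad H g x := by
  have key : ∀ v, lieDeriv H v f x = lieDeriv H v g x := fun v => by
    refine Filter.EventuallyEq.deriv_eq ?_
    have : Tendsto (curve H v x) (𝓝 0) (𝓝 x) := by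
      simpa using (hasDerivAt_curve H v x 0).continuousAt.tendsto
    exact this.eventually h
  simp only [hgrad, X, key]

theorem hgrad_eq_zero_of_notMem_tsupport (H : HeisenbergType m k) {f : Pt m k → ℝ} {x : Pt m k}
    (hx : x ∉ tsupport f) : hgrad H f x = 0 := by
  have h : f =ᶠ[𝓝 x] fun _ => 0 := notMem_tsupport_iff_eventuallyEq.mp hx
  rw [hgrad_congr H h, hgrad_eq_horiz H (differentiableAt_const _)]
  simp

/-- With no horizontal directions all brackets vanish and cannot span a nonzero centre. Needed for
the density of `{z ≠ 0}`, where the right-hand side of the equation is nonzero. -/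
theorem horizontal_dim_pos (H : HeisenbergType m k) : 0 < m := by
  rcases Nat.eq_zero_or_pos m with rfl | h
  · exfalso
    have hs := H.bracket_span
    have hz : {w | ∃ z z', H.bracket z z' = w} ⊆ {0} := by
      rintro w ⟨z, z', rfl⟩
      simp [Subsingleton.elim z 0]
    have h1 : (⊤ : Submodule ℝ (EuclideanSpace ℝ (Fin k))) ≤ ⊥ := by
      rw [← hs, Submodule.span_le]
      exact hz
    have h2 : EuclideanSpace.single (⟨0, H.center_pos⟩ : Fin k) (1 : ℝ) = 0 := by
      simpa using h1 (Submodule.mem_top (x := EuclideanSpace.single ⟨0, H.center_pos⟩ (1 : ℝ)))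
    simp at h2
  · exact h

/-! ### Sums and commutators of continuous derivatives along left-invariant fields -/

/-- On `Ω`, the function `f` has the continuous derivative `G` along the left-invariant field
with value `v` at the identity. -/
structure HasFrameDeriv (H : HeisenbergType m k) (Ω : Set (Pt m k)) (v : Pt m k)
    (f G : Pt m k → ℝ) : Prop where
  hasDerivAt_zero : ∀ x ∈ Ω, HasDerivAt (fun t : ℝ => f (curve H v x t)) (G x) 0
  continuousOn : ContinuousOn G Ω

namespace HasFrameDeriv

variable {H : HeisenbergType m k} {Ω : Set (Pt m k)} {v w : Pt m k} {f g gv gw : Pt m k → ℝ}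

theorem hasDerivAt (h : HasFrameDeriv H Ω v f g) {x : Pt m k} {t : ℝ}
    (hx : curve H v x t ∈ Ω) :
    HasDerivAt (fun t : ℝ => f (curve H v x t)) (g (curve H v x t)) t := by
  have h0 := h.hasDerivAt_zero _ hx
  rw [← sub_self t] at h0
  simpa [curve_curve] using h0.comp_sub_const t t

/-- Mean value inequality along the curve, with continuity of `g` at `x`. The expansion is uniform
over base points near `x`, which is what allows curves in different directions to be concatenated.
-/
theorem isLittleO (h : HasFrameDeriv H Ω v f g) (hΩ : IsOpen Ω) {x : Pt m k} (hx : x ∈ Ω) :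
    (fun q : Pt m k × ℝ => f (curve H v q.1 q.2) - f q.1 - q.2 * g x) =o[𝓝 (x, 0)] Prod.snd := by
  rw [Asymptotics.isLittleO_iff]
  intro ε hε
  have h1 : ∀ᶠ y in 𝓝 x, y ∈ Ω ∧ |g y - g x| < ε := by
    have := (h.continuousOn.continuousAt (hΩ.mem_nhds hx)).eventually (Metric.ball_mem_nhds _ hε)
    exact (hΩ.eventually_mem hx).and (this.mono fun y hy => by simpa [Real.dist_eq] using hy)
  have h2 : Tendsto (fun q : Pt m k × ℝ => curve H v q.1 q.2) (𝓝 (x, 0)) (𝓝 x) := by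
    simpa using (continuous_curve H v).tendsto (x, (0 : ℝ))
  obtain ⟨δ, hδ, hball⟩ := Metric.eventually_nhds_iff_ball.mp (h2.eventually h1)
  filter_upwards [Metric.ball_mem_nhds (x, (0 : ℝ)) hδ] with q hq
  have hq' : dist q.1 x < δ ∧ |q.2| < δ := by
    rw [Metric.mem_ball, Prod.dist_eq, max_lt_iff] at hq
    simpa [Real.dist_eq] using hq
  have hmem : ∀ r ∈ Metric.ball (0 : ℝ) δ, curve H v q.1 r ∈ Ω ∧
      |g (curve H v q.1 r) - g x| < ε := fun r hr => hball (q.1, r) (by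
    rw [Metric.mem_ball, Prod.dist_eq, max_lt_iff]
    exact ⟨hq'.1, hr⟩)
  have key := (convex_ball (0 : ℝ) δ).norm_image_sub_le_of_norm_hasDerivWithin_le
    (f := fun r => f (curve H v q.1 r) - r * g x)
    (f' := fun r => g (curve H v q.1 r) - g x) (C := ε) (x := 0) (y := q.2)
    (fun r hr => by
      have := (h.hasDerivAt (hmem r hr).1).fun_sub ((hasDerivAt_id r).mul_const (g x))
      simpa using this.hasDerivWithinAt)
    (fun r hr => (hmem r hr).2.le) (Metric.mem_ball_self hδ)
    (by simpa [Real.dist_eq] using hq'.2)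
  simp only [curve_zero, zero_mul, sub_zero] at key
  rw [sub_right_comm] at key
  exact key

theorem const_smul (h : HasFrameDeriv H Ω v f g) (r : ℝ) :
    HasFrameDeriv H Ω (r • v) f (fun x => r * g x) where
  hasDerivAt_zero x hx := by
    have h0 := h.hasDerivAt_zero x hx
    have h1 : HasDerivAt (fun s : ℝ => r * s) r 0 := by
      simpa using (hasDerivAt_id (0 : ℝ)).const_mul r
    rw [← mul_zero r] at h0
    have h2 := HasDerivAt.comp 0 h0 h1
    simpa [Function.comp_def, curve_smul, mul_comm] using h2
  continuousOn := continuousOn_const.mul h.continuousOn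

theorem zero : HasFrameDeriv H Ω 0 f (fun _ => 0) where
  hasDerivAt_zero x _ := by
    have : (fun t : ℝ => f (curve H 0 x t)) = fun _ => f x := by
      funext t
      have : frameVec H 0 x = 0 := by simpa using frameVec_smul H 0 0 x
      simp [curve_eq, this]
    rw [this]
    exact hasDerivAt_const _ _
  continuousOn := continuousOn_const

/-- Baker-Campbell-Hausdorff in step two: `exp(tv) exp(tw) exp(-t²/2 [v,w]) = exp(t(v+w))`. -/
theorem curve_add (x : Pt m k) (t : ℝ) :
    curve H (0, H.bracket v.1 w.1) (curve H w (curve H v x t) t) (-(t ^ 2) / 2) =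
      curve H (v + w) x t := by
  ext1
  · simp [curve, mul, add_assoc]
  · simp only [curve, mul, Prod.smul_fst, Prod.smul_snd, Prod.snd_add, Prod.fst_add, smul_add,
      map_smul, map_add, smul_zero, map_zero, add_zero, LinearMap.add_apply, LinearMap.smul_apply]
    module

/-- Move along `v`, then `w`, then correct by `-t²/2` in the direction `[v,w]`. The correction
changes `f` by `O(t²)`, provided that `f` is differentiable in that direction; hence the hypothesis
`hu`. -/
theorem add (hv : HasFrameDeriv H Ω v f gv) (hw : HasFrameDeriv H Ω w f gw)
    (hu : HasFrameDeriv H Ω (0, H.bracket v.1 w.1) f g) (hΩ : IsOpen Ω) :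
    HasFrameDeriv H Ω (v + w) f (fun x => gv x + gw x) where
  hasDerivAt_zero x hx := by
    have c1 : Tendsto (fun t : ℝ => curve H v x t) (𝓝 0) (𝓝 x) := by
      simpa [Function.comp_def] using ((continuous_curve H v).comp (Continuous.prodMk_right x)).tendsto 0
    have c2 : Tendsto (fun t : ℝ => curve H w (curve H v x t) t) (𝓝 0) (𝓝 x) := by
      have := ((continuous_curve H w).tendsto (x, 0)).comp (c1.prodMk_nhds tendsto_id)
      simpa [Function.comp_def] using this
    have c3 : Tendsto (fun t : ℝ => -(t ^ 2) / 2) (𝓝 0) (𝓝 0) := by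
      have : Continuous fun t : ℝ => -(t ^ 2) / 2 := by fun_prop
      simpa using this.tendsto 0
    have c0 : Tendsto (fun _ : ℝ => x) (𝓝 0) (𝓝 x) := tendsto_const_nhds
    have e1 := (hv.isLittleO hΩ hx).comp_tendsto (c0.prodMk_nhds tendsto_id)
    have e2 := (hw.isLittleO hΩ hx).comp_tendsto (c1.prodMk_nhds tendsto_id)
    have e3 := (hu.isLittleO hΩ hx).comp_tendsto (c2.prodMk_nhds c3)
    have o1 : (fun t : ℝ => -(t ^ 2) / 2) =o[𝓝 0] (fun t : ℝ => t) := by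
      have : (fun t : ℝ => t ^ 2) =o[𝓝 0] (fun t : ℝ => t) := by
        simpa using Asymptotics.isLittleO_pow_pow (𝕜 := ℝ) (m := 1) (n := 2) one_lt_two
      have h' := this.const_mul_left (-1 / 2)
      refine h'.congr_left fun t => by ring
    have e3' := (e3.trans o1).add (o1.const_mul_left (g x))
    have e := (e1.add e2).add e3'
    rw [hasDerivAt_iff_isLittleO]
    simp only [sub_zero, curve_zero]
    refine e.congr (fun t => ?_) (fun t => rfl)
    simp only [Function.comp_apply, id, curve_add, smul_eq_mul]
    ring
  continuousOn := hv.continuousOn.add hw.continuousOn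

/-- For fixed `t`, differentiate in `r` the difference of `f` along the two `w`-curves from `y
exp(tv)` and from `y`. Its derivative is a difference of values of `gw`, equal to `t * gwv x` up to
`o(t)`; the mean value inequality over `|r| ≤ |t|` then gives `o(t²)`. -/
theorem isLittleO_second_difference {gwv gww : Pt m k → ℝ} (hw : HasFrameDeriv H Ω w f gw)
    (hwv : HasFrameDeriv H Ω v gw gwv) (hww : HasFrameDeriv H Ω w gw gww) (hΩ : IsOpen Ω)
    {x : Pt m k} (hx : x ∈ Ω) :
    (fun q : Pt m k × ℝ => f (curve H w (curve H v q.1 q.2) q.2) - f (curve H v q.1 q.2) -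
      f (curve H w q.1 q.2) + f q.1 - q.2 ^ 2 * gwv x) =o[𝓝 (x, 0)] fun q => q.2 ^ 2 := by
  have cy : Tendsto (fun q : Pt m k × ℝ × ℝ => q.1) (𝓝 (x, 0, 0)) (𝓝 x) :=
    (continuous_fst.tendsto _)
  have ct : Tendsto (fun q : Pt m k × ℝ × ℝ => q.2.1) (𝓝 (x, 0, 0)) (𝓝 0) :=
    ((continuous_fst.comp continuous_snd).tendsto _)
  have cr : Tendsto (fun q : Pt m k × ℝ × ℝ => q.2.2) (𝓝 (x, 0, 0)) (𝓝 0) :=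
    ((continuous_snd.comp continuous_snd).tendsto _)
  have cv : Tendsto (fun q : Pt m k × ℝ × ℝ => curve H v q.1 q.2.1) (𝓝 (x, 0, 0)) (𝓝 x) := by
    simpa [Function.comp_def] using
      ((continuous_curve H v).tendsto (x, 0)).comp (cy.prodMk_nhds ct)
  have cw : Tendsto (fun q : Pt m k × ℝ × ℝ => curve H w q.1 q.2.2) (𝓝 (x, 0, 0)) (𝓝 x) := by
    simpa [Function.comp_def] using
      ((continuous_curve H w).tendsto (x, 0)).comp (cy.prodMk_nhds cr)
  have cvw : Tendsto (fun q : Pt m k × ℝ × ℝ => curve H w (curve H v q.1 q.2.1) q.2.2)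
      (𝓝 (x, 0, 0)) (𝓝 x) := by
    simpa [Function.comp_def] using
      ((continuous_curve H w).tendsto (x, 0)).comp (cv.prodMk_nhds cr)
  rw [Asymptotics.isLittleO_iff]
  intro ε hε
  -- The points `y exp(tv) exp(rw)` and `y exp(rw)` are not on a common `v`-curve, so their
  -- `gw`-values are compared through `y exp(tv)` and `y`. The two terms `r * gww x` cancel, leaving
  -- three errors of size `ε/3`.
  have e1 := Asymptotics.isLittleO_iff.mp
    ((hww.isLittleO hΩ hx).comp_tendsto (cv.prodMk_nhds cr)) (c := ε / 3) (by positivity)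
  have e2 := Asymptotics.isLittleO_iff.mp
    ((hwv.isLittleO hΩ hx).comp_tendsto (cy.prodMk_nhds ct)) (c := ε / 3) (by positivity)
  have e3 := Asymptotics.isLittleO_iff.mp
    ((hww.isLittleO hΩ hx).comp_tendsto (cy.prodMk_nhds cr)) (c := ε / 3) (by positivity)
  obtain ⟨δ, hδ, hball⟩ := Metric.eventually_nhds_iff_ball.mp
    (((e1.and e2).and e3).and ((cw.eventually (hΩ.eventually_mem hx)).and
      (cvw.eventually (hΩ.eventually_mem hx))))
  filter_upwards [Metric.ball_mem_nhds (x, (0 : ℝ)) hδ] with q hq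
  obtain ⟨y, t⟩ := q
  have hq' : dist y x < δ ∧ |t| < δ := by
    rw [Metric.mem_ball, Prod.dist_eq, max_lt_iff] at hq
    simpa [Real.dist_eq] using hq
  have hmem : ∀ r ∈ Metric.closedBall (0 : ℝ) |t|, curve H w y r ∈ Ω ∧
      curve H w (curve H v y t) r ∈ Ω ∧
      |gw (curve H w (curve H v y t) r) - gw (curve H w y r) - t * gwv x| ≤ ε * |t| := by
    intro r hr
    have hr' : |r| ≤ |t| := by simpa using hr
    obtain ⟨⟨⟨a1, a2⟩, a3⟩, a4, a5⟩ := hball (y, t, r) (by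
      rw [Metric.mem_ball, Prod.dist_eq (α := Pt m k), max_lt_iff, Prod.dist_eq (α := ℝ),
        max_lt_iff, Real.dist_eq, Real.dist_eq, sub_zero, sub_zero]
      exact ⟨hq'.1, hq'.2, hr'.trans_lt hq'.2⟩)
    refine ⟨a4, a5, ?_⟩
    simp only [Function.comp_apply, Real.norm_eq_abs] at a1 a2 a3
    rw [abs_le] at a1 a2 a3 ⊢
    constructor <;> nlinarith
  have key := (convex_closedBall (0 : ℝ) |t|).norm_image_sub_le_of_norm_hasDerivWithin_le
    (f := fun r => f (curve H w (curve H v y t) r) - f (curve H w y r) - r * (t * gwv x))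
    (f' := fun r => gw (curve H w (curve H v y t) r) - gw (curve H w y r) - t * gwv x)
    (C := ε * |t|) (x := 0) (y := t)
    (fun r hr => by
      have := ((hw.hasDerivAt (hmem r hr).2.1).fun_sub (hw.hasDerivAt (hmem r hr).1)).fun_sub
        ((hasDerivAt_id r).mul_const (t * gwv x))
      simpa using this.hasDerivWithinAt)
    (fun r hr => (hmem r hr).2.2) (Metric.mem_closedBall_self (abs_nonneg t)) (by simp)
  simp only [curve_zero, zero_mul, sub_zero, Real.norm_eq_abs] at key
  rw [Real.norm_eq_abs, Real.norm_eq_abs, abs_of_nonneg (sq_nonneg t)]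
  calc _ ≤ ε * |t| * |t| := by
        convert key using 2
        ring
    _ = ε * t ^ 2 := by rw [mul_assoc, ← sq, sq_abs]

theorem curve_commutator (y : Pt m k) (t : ℝ) :
    curve H w (curve H v y t) t =
      curve H (0, H.bracket v.1 w.1) (curve H v (curve H w y t) t) (t ^ 2) := by
  ext1
  · simp only [curve, mul, Prod.smul_fst, smul_zero, add_zero]
    module
  · simp only [curve, mul, Prod.smul_fst, Prod.smul_snd, smul_add,
      map_smul, map_add, smul_zero, map_zero, add_zero, LinearMap.add_apply, LinearMap.smul_apply]
    rw [bracket_swap H w.1 v.1]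
    module

/-- The second differences for `v, w` and for `w, v` share all terms except the far corner. The two
corners differ by `exp(t² [v,w])`, so subtracting leaves the increment of `f` in the direction
`[v,w]` over the time `t²`. -/
theorem isLittleO_commutator {gwv gww gvw gvv : Pt m k → ℝ} (hv : HasFrameDeriv H Ω v f gv)
    (hw : HasFrameDeriv H Ω w f gw)
    (hwv : HasFrameDeriv H Ω v gw gwv) (hww : HasFrameDeriv H Ω w gw gww)
    (hvw : HasFrameDeriv H Ω w gv gvw) (hvv : HasFrameDeriv H Ω v gv gvv) (hΩ : IsOpen Ω)
    {x : Pt m k} (hx : x ∈ Ω) :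
    (fun t : ℝ => f (curve H (0, H.bracket v.1 w.1) x (t ^ 2)) - f x - t ^ 2 * (gwv x - gvw x))
      =o[𝓝 0] fun t => t ^ 2 := by
  -- The base point moves with `t` so that the far corner `y exp(tw) exp(tv)` is exactly `x`;
  -- uniformity in the base point makes this harmless.
  let y : ℝ → Pt m k := fun t => curve H w (curve H v x (-t)) (-t)
  have hy : Tendsto y (𝓝 0) (𝓝 x) := by
    have c : Continuous y := (continuous_curve H w).comp
      (((continuous_curve H v).comp (continuous_const.prodMk continuous_neg)).prodMk
        continuous_neg)
    simpa [y] using c.tendsto 0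
  have hyx : ∀ t, curve H v (curve H w (y t) t) t = x := fun t => by
    simp [y, curve_curve]
  have e1 := (isLittleO_second_difference hw hwv hww hΩ hx).comp_tendsto
    (hy.prodMk_nhds tendsto_id)
  have e2 := (isLittleO_second_difference hv hvw hvv hΩ hx).comp_tendsto
    (hy.prodMk_nhds tendsto_id)
  refine (e1.sub e2).congr (fun t => ?_) (fun t => rfl)
  simp only [Function.comp_apply, id, curve_commutator (v := v) (w := w) (y t) t, hyx]
  ring

/-- The time `t²` in the commutator expansion reaches only nonnegative parameters. Negative ones
come from exchanging `v` and `w`, which reverses the bracket. -/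
theorem bracket {gwv gww gvw gvv : Pt m k → ℝ} (hv : HasFrameDeriv H Ω v f gv)
    (hw : HasFrameDeriv H Ω w f gw)
    (hwv : HasFrameDeriv H Ω v gw gwv) (hww : HasFrameDeriv H Ω w gw gww)
    (hvw : HasFrameDeriv H Ω w gv gvw) (hvv : HasFrameDeriv H Ω v gv gvv) (hΩ : IsOpen Ω) :
    HasFrameDeriv H Ω (0, H.bracket v.1 w.1) f (fun x => gwv x - gvw x) where
  hasDerivAt_zero x hx := by
    have e1 := isLittleO_commutator hv hw hwv hww hvw hvv hΩ hx
    have e2 := isLittleO_commutator hw hv hvw hvv hwv hww hΩ hx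
    have hneg : ((0, H.bracket w.1 v.1) : Pt m k) = (-1 : ℝ) • (0, H.bracket v.1 w.1) := by
      rw [bracket_swap H w.1 v.1]; simp
    simp only [hneg, curve_smul] at e2
    rw [hasDerivAt_iff_isLittleO, Asymptotics.isLittleO_iff]
    intro ε hε
    have hs : Tendsto (fun τ : ℝ => √|τ|) (𝓝 0) (𝓝 0) := by
      have : Continuous fun τ : ℝ => √|τ| := by fun_prop
      simpa using this.tendsto 0
    filter_upwards [hs.eventually (Asymptotics.isLittleO_iff.mp e1 hε),
      hs.eventually (Asymptotics.isLittleO_iff.mp e2 hε)] with τ h1 h2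
    rw [Real.sq_sqrt (abs_nonneg τ)] at h1 h2
    simp only [sub_zero, curve_zero, smul_eq_mul, Real.norm_eq_abs, abs_abs] at h1 h2 ⊢
    rcases le_total 0 τ with hτ | hτ
    · rwa [abs_of_nonneg hτ] at h1 ⊢
    · rw [abs_of_nonpos hτ] at h2 ⊢
      convert h2 using 2
      ring_nf
  continuousOn := hwv.continuousOn.sub hvw.continuousOn

end HasFrameDeriv

theorem IsGamma0.continuousOn {H : HeisenbergType m k} {α : ℝ} (hα : 0 < α) {Ω : Set (Pt m k)}
    {u : Pt m k → ℝ} (hu : IsGamma0 H α Ω u) : ContinuousOn u Ω := by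
  obtain ⟨M, -, hM⟩ := hu
  intro x hx
  have hc : Continuous fun y => M * gaugeDist H x y ^ α := by
    have h1 : Continuous fun y => mul H (-x) y :=
      (continuous_mul H).comp (Continuous.prodMk_right (-x))
    have h2 : Continuous fun y => gaugeDist H x y := by
      unfold gaugeDist gauge
      refine Continuous.rpow_const ?_ fun _ => Or.inr (by norm_num)
      exact ((continuous_norm.comp (continuous_fst.comp h1)).pow 4).add
        (continuous_const.mul ((continuous_norm.comp (continuous_snd.comp h1)).pow 2))
    exact continuous_const.mul (h2.rpow_const fun _ => Or.inr hα.le)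
  have h0 : M * gaugeDist H x x ^ α = 0 := by
    have : gaugeDist H x x = 0 := by
      have hz : mul H (-x) x = 0 := by ext1 <;> simp [mul, H.bracket_self]
      rw [gaugeDist, hz]
      simp [gauge]
    rw [this, Real.zero_rpow hα.ne', mul_zero]
  have ht : Tendsto (fun y => M * gaugeDist H x y ^ α) (𝓝[Ω] x) (𝓝 0) := by
    have := (hc.tendsto x).mono_left (nhdsWithin_le_nhds (s := Ω))
    rwa [h0] at this
  rw [ContinuousWithinAt, tendsto_iff_dist_tendsto_zero]
  refine squeeze_zero' (Eventually.of_forall fun _ => dist_nonneg) ?_ ht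
  filter_upwards [self_mem_nhdsWithin] with y hy
  rw [dist_comm, Real.dist_eq]
  exact hM x hx y hy

/-- The central directions along which `f` has a continuous derivative form a subspace, as the
centre is commutative. It contains the brackets of basis vectors, which span the centre. -/
theorem exists_hasFrameDeriv_center {H : HeisenbergType m k} {Ω : Set (Pt m k)}
    {f : Pt m k → ℝ} (hΩ : IsOpen Ω)
    (hB : ∀ i j, ∃ g, HasFrameDeriv H Ω
      (0, H.bracket (EuclideanSpace.single i 1) (EuclideanSpace.single j 1)) f g)
    (w : EuclideanSpace ℝ (Fin k)) : ∃ g, HasFrameDeriv H Ω (0, w) f g := by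
  let S : Submodule ℝ (EuclideanSpace ℝ (Fin k)) :=
    { carrier := {w | ∃ g, HasFrameDeriv H Ω (0, w) f g}
      zero_mem' := ⟨_, HasFrameDeriv.zero⟩
      add_mem' := by
        rintro a b ⟨g, hg⟩ ⟨g', hg'⟩
        have h0 : HasFrameDeriv H Ω
            (0, H.bracket ((0, a) : Pt m k).1 ((0, b) : Pt m k).1) f (fun _ => 0) := by
          simpa [← Prod.zero_eq_mk] using (HasFrameDeriv.zero (H := H) (Ω := Ω) (f := f))
        have h1 := hg.add hg' h0 hΩ
        rw [Prod.mk_add_mk, add_zero] at h1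
        exact ⟨_, h1⟩
      smul_mem' := by
        rintro r a ⟨g, hg⟩
        exact ⟨_, by simpa using hg.const_smul r⟩ }
  have hS : S = ⊤ := by
    rw [eq_top_iff, ← H.bracket_span, Submodule.span_le]
    rintro _ ⟨z, z', rfl⟩
    have hz : ∀ z : EuclideanSpace ℝ (Fin m),
        z = ∑ i, z i • EuclideanSpace.single i (1 : ℝ) := fun z => by
      ext j; simp [Pi.single_apply]
    rw [hz z', map_sum]
    refine S.sum_mem fun j _ => ?_
    rw [map_smul]
    refine S.smul_mem _ ?_
    rw [hz z, map_sum, LinearMap.sum_apply]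
    refine S.sum_mem fun i _ => ?_
    rw [map_smul, LinearMap.smul_apply]
    exact S.smul_mem _ (hB i j)
  have : w ∈ S := hS ▸ Submodule.mem_top
  exact this

theorem exists_hasFrameDeriv {H : HeisenbergType m k} {Ω : Set (Pt m k)}
    {f : Pt m k → ℝ} (hΩ : IsOpen Ω)
    (hX : ∀ i, ∃ g, HasFrameDeriv H Ω (hBasis m k i) f g)
    (hT : ∀ w, ∃ g, HasFrameDeriv H Ω (0, w) f g) (v : Pt m k) :
    ∃ g, HasFrameDeriv H Ω v f g := by
  let S : Submodule ℝ (Pt m k) :=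
    { carrier := {v | ∃ g, HasFrameDeriv H Ω v f g}
      zero_mem' := ⟨_, HasFrameDeriv.zero⟩
      add_mem' := by
        rintro a b ⟨g, hg⟩ ⟨g', hg'⟩
        exact ⟨_, hg.add hg' (hT _).choose_spec hΩ⟩
      smul_mem' := by
        rintro r a ⟨g, hg⟩
        exact ⟨_, hg.const_smul r⟩ }
  have : v ∈ S := by
    rw [sum_hBasis_add_sum_vBasis v]
    exact S.add_mem (S.sum_mem fun i _ => S.smul_mem _ (hX i))
      (S.sum_mem fun l _ => S.smul_mem _ (hT _))
  exact this

theorem HasFrameDeriv.eq_lieDeriv {H : HeisenbergType m k} {Ω : Set (Pt m k)} {v : Pt m k}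
    {f g : Pt m k → ℝ} (h : HasFrameDeriv H Ω v f g) {x : Pt m k} (hx : x ∈ Ω) :
    g x = lieDeriv H v f x :=
  (h.hasDerivAt_zero x hx).deriv.symm

section

variable {H : HeisenbergType m k} {Ω : Set (Pt m k)} {f : Pt m k → ℝ}

theorem lieDeriv_eq_inner_rgrad (hΩ : IsOpen Ω) (hf : ∀ v, ∃ g, HasFrameDeriv H Ω v f g)
    {x : Pt m k} (hx : x ∈ Ω) (v : Pt m k) :
    lieDeriv H v f x = inner ℝ (rgrad H f x).1 v.1 + inner ℝ (rgrad H f x).2 v.2 := by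
  choose g hg using hf
  let L : Pt m k →ₗ[ℝ] ℝ :=
    { toFun := fun v => lieDeriv H v f x
      map_add' := fun a b => by
        rw [← ((hg a).add (hg b) (hg _) hΩ).eq_lieDeriv hx, (hg a).eq_lieDeriv hx,
          (hg b).eq_lieDeriv hx]
      map_smul' := fun r a => by
        rw [← ((hg a).const_smul r).eq_lieDeriv hx, (hg a).eq_lieDeriv hx]; rfl }
  change L v = _
  conv_lhs => rw [sum_hBasis_add_sum_vBasis v]
  simp only [map_add, map_sum, map_smul, rgrad, hgrad, X, T, PiLp.inner_apply, L,
    LinearMap.coe_mk, AddHom.coe_mk, smul_eq_mul, RCLike.inner_apply, conj_trivial]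

theorem continuousOn_rgrad (hf : ∀ v, ∃ g, HasFrameDeriv H Ω v f g) :
    ContinuousOn (rgrad H f) Ω := by
  have h : ∀ v, ContinuousOn (lieDeriv H v f) Ω := fun v => by
    obtain ⟨g, hg⟩ := hf v
    exact hg.continuousOn.congr fun x hx => (hg.eq_lieDeriv hx).symm
  refine ContinuousOn.prodMk ?_ ?_
  · exact (PiLp.continuous_toLp 2 _).comp_continuousOn (continuousOn_pi.2 fun i => h _)
  · exact (PiLp.continuous_toLp 2 _).comp_continuousOn (continuousOn_pi.2 fun i => h _)

/-- The usual argument from continuous partial derivatives, in the left-invariant frame: every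
segment from `x` is an integral curve of one left-invariant field, along which the derivative of `f`
is a pairing with the continuous `rgrad H f`. -/
theorem differentiableAt_of_hasFrameDeriv (hΩ : IsOpen Ω) (hf : ∀ v, ∃ g, HasFrameDeriv H Ω v f g)
    {x : Pt m k} (hx : x ∈ Ω) : DifferentiableAt ℝ f x := by
  -- `V` inverts `v ↦ frameVec H v x`: it turns a coordinate direction into frame coordinates at
  -- `x`.
  let V : Pt m k →L[ℝ] Pt m k := LinearMap.toContinuousLinearMap
    { toFun := fun w => (w.1, w.2 - (1 / 2 : ℝ) • H.bracket x.1 w.1)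
      map_add' := fun a b => by
        ext1
        · rfl
        · simp only [Prod.snd_add, Prod.fst_add, map_add]; module
      map_smul' := fun r a => by
        ext1
        · rfl
        · simp only [Prod.smul_snd, Prod.smul_fst, map_smul, RingHom.id_apply]; module }
  have hV : ∀ w, frameVec H (V w) x = w := fun w => by ext1 <;> simp [frameVec, V]
  let R := rgrad H f x
  let L : Pt m k →L[ℝ] ℝ :=
    (((innerSL ℝ R.1).comp (ContinuousLinearMap.fst ℝ _ _)) +
      ((innerSL ℝ R.2).comp (ContinuousLinearMap.snd ℝ _ _))).comp V
  have hL : ∀ w, L w = lieDeriv H (V w) f x := fun w => by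
    rw [lieDeriv_eq_inner_rgrad hΩ hf hx]
    simp [L, R]
  suffices h : HasFDerivAt f L x from h.differentiableAt
  rw [hasFDerivAt_iff_isLittleO_nhds_zero, Asymptotics.isLittleO_iff]
  intro ε hε
  set C := ‖V‖ + 1
  have hC : 0 < C := by positivity
  -- The pairing is a sum of two inner products, each at most `‖rgrad H f y - R‖ * ‖V w‖ ≤ ‖rgrad H
  -- f y - R‖ * (C * ‖w‖)`; hence the factor `2 * C`.
  have h1 : ∀ᶠ y in 𝓝 x, y ∈ Ω ∧ ‖rgrad H f y - R‖ < ε / (2 * C) := by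
    have := ((continuousOn_rgrad hf).continuousAt (hΩ.mem_nhds hx)).eventually
      (Metric.ball_mem_nhds _ (show 0 < ε / (2 * C) by positivity))
    exact (hΩ.eventually_mem hx).and (this.mono fun y hy => by simpa [dist_eq_norm] using hy)
  obtain ⟨δ, hδ, hball⟩ := Metric.eventually_nhds_iff_ball.mp h1
  filter_upwards [Metric.ball_mem_nhds 0 hδ] with w hw
  have hw' : ‖w‖ < δ := by simpa using hw
  have hcurve : ∀ t, curve H (V w) x t = x + t • w := fun t => by rw [curve_eq, hV]
  obtain ⟨g, hg⟩ := hf (V w)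
  have hmem : ∀ t ∈ Set.Icc (0 : ℝ) 1, curve H (V w) x t ∈ Ω ∧
      ‖g (curve H (V w) x t) - g x‖ ≤ ε * ‖w‖ := by
    intro t ht
    obtain ⟨h2, h3⟩ := hball (curve H (V w) x t) (by
      rw [hcurve, Metric.mem_ball, dist_self_add_left, norm_smul, Real.norm_of_nonneg ht.1]
      calc t * ‖w‖ ≤ 1 * ‖w‖ := by gcongr; exact ht.2
        _ < δ := by simpa using hw')
    refine ⟨h2, ?_⟩
    set y := curve H (V w) x t
    rw [hg.eq_lieDeriv h2, hg.eq_lieDeriv hx, lieDeriv_eq_inner_rgrad hΩ hf h2,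
      lieDeriv_eq_inner_rgrad hΩ hf hx]
    have e : inner ℝ (rgrad H f y).1 (V w).1 + inner ℝ (rgrad H f y).2 (V w).2 -
        (inner ℝ (rgrad H f x).1 (V w).1 + inner ℝ (rgrad H f x).2 (V w).2) =
        inner ℝ (rgrad H f y - R).1 (V w).1 + inner ℝ (rgrad H f y - R).2 (V w).2 := by
      simp only [Prod.fst_sub, Prod.snd_sub, inner_sub_left, R]; ring
    rw [e]
    have hVw : ‖V w‖ ≤ C * ‖w‖ := (V.le_opNorm w).trans (by gcongr; simp [C])
    calc _ ≤ ‖(rgrad H f y - R).1‖ * ‖(V w).1‖ + ‖(rgrad H f y - R).2‖ * ‖(V w).2‖ :=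
          (norm_add_le _ _).trans (add_le_add (norm_inner_le_norm _ _) (norm_inner_le_norm _ _))
      _ ≤ ‖rgrad H f y - R‖ * ‖V w‖ + ‖rgrad H f y - R‖ * ‖V w‖ := by
          gcongr
          · exact norm_fst_le _
          · exact norm_fst_le _
          · exact norm_snd_le _
          · exact norm_snd_le _
      _ ≤ ε / (2 * C) * (C * ‖w‖) + ε / (2 * C) * (C * ‖w‖) := by gcongr
      _ = ε * ‖w‖ := by field_simp; ring
  have key := (convex_Icc (0 : ℝ) 1).norm_image_sub_le_of_norm_hasDerivWithin_le
    (f := fun r => f (curve H (V w) x r) - r * g x)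
    (f' := fun r => g (curve H (V w) x r) - g x)
    (C := ε * ‖w‖) (x := 0) (y := 1)
    (fun r hr => by
      have := (hg.hasDerivAt (hmem r hr).1).fun_sub ((hasDerivAt_id r).mul_const (g x))
      simpa using this.hasDerivWithinAt)
    (fun r hr => (hmem r hr).2) (by simp) (by simp)
  rw [hL, ← hg.eq_lieDeriv hx]
  simp only [hcurve, one_smul, zero_smul, add_zero, zero_mul, one_mul, sub_zero, norm_one,
    mul_one] at key
  rw [sub_right_comm]
  exact key

theorem contDiffOn_of_hasFrameDeriv (hΩ : IsOpen Ω) (hf : ∀ v, ∃ g, HasFrameDeriv H Ω v f g) :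
    ContDiffOn ℝ 1 f Ω := by
  have hd : ∀ x ∈ Ω, DifferentiableAt ℝ f x := fun x hx => differentiableAt_of_hasFrameDeriv hΩ hf hx
  have : ContDiffOn ℝ (0 + 1) f Ω := by
    rw [contDiffOn_succ_iff_fderiv_of_isOpen hΩ]
    refine ⟨fun x hx => (hd x hx).differentiableWithinAt, by simp, ?_⟩
    rw [contDiffOn_zero, continuousOn_clm_apply]
    intro w
    have hc : ContinuousOn (fun x => inner ℝ (rgrad H f x).1 w.1 +
        inner ℝ (rgrad H f x).2 (w.2 - (1 / 2 : ℝ) • H.bracket x.1 w.1)) Ω := by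
      have hr := continuousOn_rgrad hf
      have hb : Continuous fun x : Pt m k => H.bracket x.1 w.1 :=
        (continuous_bracket H).comp (continuous_fst.prodMk continuous_const)
      have h1 : ContinuousOn (fun x => (rgrad H f x).1) Ω := continuous_fst.comp_continuousOn hr
      have h2 : ContinuousOn (fun x => (rgrad H f x).2) Ω := continuous_snd.comp_continuousOn hr
      have h3 : Continuous fun x : Pt m k => w.2 - (1 / 2 : ℝ) • H.bracket x.1 w.1 := by
        fun_prop
      exact (h1.inner continuousOn_const).add (h2.inner h3.continuousOn)
    refine hc.congr fun x hx => ?_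
    have := fderiv_frameVec_eq_inner H (hd x hx) (w.1, w.2 - (1 / 2 : ℝ) • H.bracket x.1 w.1)
    refine Eq.trans ?_ this
    congr 1
    ext1 <;> simp [frameVec]
  simpa using this

end

theorem IsGamma2.contDiffOn {H : HeisenbergType m k} {α : ℝ} (hα : 0 < α) {Ω : Set (Pt m k)}
    (hΩ : IsOpen Ω) {f : Pt m k → ℝ} (hf : IsGamma2 H α Ω f) : ContDiffOn ℝ 1 f Ω := by
  have h1 : ∀ i, HasFrameDeriv H Ω (hBasis m k i) f (X H i f) := fun i =>
    ⟨fun x hx => (hf.diff_one i x hx).hasDerivAt, (hf.holder_one i).continuousOn hα⟩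
  have h2 : ∀ i j, HasFrameDeriv H Ω (hBasis m k i) (X H j f) (X H i (X H j f)) := fun i j =>
    ⟨fun x hx => (hf.diff_two i j x hx).hasDerivAt, (hf.holder_two i j).continuousOn hα⟩
  exact contDiffOn_of_hasFrameDeriv hΩ (exists_hasFrameDeriv hΩ (fun i => ⟨_, h1 i⟩)
    (exists_hasFrameDeriv_center hΩ fun i j =>
      ⟨_, (h1 i).bracket (h1 j) (h2 i j) (h2 j j) (h2 j i) (h2 i i) hΩ⟩))

/-! ### Mollification and admissibility of `C¹` test functions -/

instance isAddHaarMeasure_volume : (volume : Measure (Pt m k)).IsAddHaarMeasure :=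
  inferInstanceAs ((volume : Measure (EuclideanSpace ℝ (Fin m))).prod
    (volume : Measure (EuclideanSpace ℝ (Fin k)))).IsAddHaarMeasure

instance isNegInvariant_volume : (volume : Measure (Pt m k)).IsNegInvariant :=
  Measure.IsAddHaarMeasure.isNegInvariant_of_regular _

/-- Convolve with a bump function. The derivative falls on `φ`, so uniform continuity of `φ` and of
`fderiv ℝ φ` controls both errors. -/
theorem exists_isTest_near {φ : Pt m k → ℝ} (hφ : ContDiff ℝ 1 φ) (hc : HasCompactSupport φ)
    {Ω : Set (Pt m k)} (hΩ : IsOpen Ω) (hs : tsupport φ ⊆ Ω) {ε : ℝ} (hε : 0 < ε) :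
    ∃ ψ, IsTest Ω ψ ∧ ∀ x, |ψ x - φ x| ≤ ε ∧ ‖fderiv ℝ ψ x - fderiv ℝ φ x‖ ≤ ε := by
  obtain ⟨δ, hδ, hδΩ⟩ := hc.isCompact.exists_cthickening_subset_open hΩ hs
  have hD : Continuous (fderiv ℝ φ) := hφ.continuous_fderiv one_ne_zero
  obtain ⟨δ₁, hδ₁, h₁⟩ := Metric.uniformContinuous_iff.mp
    (hc.uniformContinuous_of_continuous hφ.continuous) ε hε
  obtain ⟨δ₂, hδ₂, h₂⟩ := Metric.uniformContinuous_iff.mp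
    ((hc.fderiv (𝕜 := ℝ)).uniformContinuous_of_continuous hD) ε hε
  set r := min δ (min δ₁ δ₂)
  have hr : 0 < r := lt_min hδ (lt_min hδ₁ hδ₂)
  let b : ContDiffBump (0 : Pt m k) := ⟨r / 2, r, by positivity, by linarith⟩
  let ψ : Pt m k → ℝ :=
    MeasureTheory.convolution (b.normed volume) φ (ContinuousLinearMap.lsmul ℝ ℝ) volume
  have hsub : Function.support ψ ⊆ Metric.cthickening δ (tsupport φ) := by
    refine (MeasureTheory.support_convolution_subset _).trans ?_
    rintro x ⟨u, hu, y, hy, rfl⟩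
    rw [b.support_normed_eq, Metric.mem_ball, dist_zero_right] at hu
    refine Metric.mem_cthickening_of_dist_le _ y δ _ (subset_tsupport _ hy) ?_
    rw [dist_eq_norm, add_sub_cancel_right]
    exact (hu.le.trans (min_le_left _ _))
  have htsub : tsupport ψ ⊆ Metric.cthickening δ (tsupport φ) :=
    closure_minimal hsub Metric.isClosed_cthickening
  have hψc : HasCompactSupport ψ :=
    (hc.isCompact.cthickening (r := δ)).of_isClosed_subset isClosed_closure htsub
  have hlφ : LocallyIntegrable φ volume := hφ.continuous.locallyIntegrable
  have hfd : ∀ x, HasFDerivAt ψ (MeasureTheory.convolution (b.normed volume) (fderiv ℝ φ)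
      (ContinuousLinearMap.lsmul ℝ ℝ) volume x) x := fun x => by
    have h := hc.hasFDerivAt_convolution_right (ContinuousLinearMap.lsmul ℝ ℝ)
      (b.continuous_normed (μ := volume)).locallyIntegrable hφ x (μ := volume)
    have e : (ContinuousLinearMap.lsmul ℝ ℝ : ℝ →L[ℝ] ℝ →L[ℝ] ℝ).precompR (Pt m k) =
        (ContinuousLinearMap.lsmul ℝ ℝ : ℝ →L[ℝ] (Pt m k →L[ℝ] ℝ) →L[ℝ] (Pt m k →L[ℝ] ℝ)) := by
      refine ContinuousLinearMap.ext fun a => ContinuousLinearMap.ext fun L =>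
        ContinuousLinearMap.ext fun w => ?_
      simp [ContinuousLinearMap.precompR_apply]
    rwa [e] at h
  refine ⟨ψ, ⟨?_, hψc, htsub.trans hδΩ⟩, fun x => ⟨?_, ?_⟩⟩
  · exact b.hasCompactSupport_normed.contDiff_convolution_left _ b.contDiff_normed hlφ
  · rw [← Real.dist_eq]
    refine b.dist_normed_convolution_le hφ.continuous.aestronglyMeasurable fun y hy => ?_
    exact (h₁ (lt_of_lt_of_le hy ((min_le_right _ _).trans (min_le_left _ _)))).le
  · rw [(hfd x).fderiv, ← dist_eq_norm]
    refine b.dist_normed_convolution_le hD.aestronglyMeasurable fun y hy => ?_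
    exact (h₂ (lt_of_lt_of_le hy ((min_le_right _ _).trans (min_le_right _ _)))).le

theorem exists_norm_horiz_le (H : HeisenbergType m k) {K : Set (Pt m k)}
    (hK : Bornology.IsBounded K) : ∃ C, 0 ≤ C ∧ ∀ x ∈ K, ∀ L, ‖horiz H x L‖ ≤ C * ‖L‖ := by
  obtain ⟨C, hC⟩ := (hK.isCompact_closure.prod
    (isCompact_closedBall (0 : Pt m k →L[ℝ] ℝ) 1)).exists_bound_of_continuousOn
      (continuous_horiz H).continuousOn
  refine ⟨max C 0, le_max_right _ _, fun x hx L => ?_⟩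
  have h := hC (x, ‖L‖⁻¹ • L) ⟨subset_closure hx, by
    rw [mem_closedBall_zero_iff, norm_smul, norm_inv, norm_norm]
    exact inv_mul_le_one⟩
  rcases eq_or_ne L 0 with rfl | hL
  · simp
  · have hL' : 0 < ‖L‖ := norm_pos_iff.mpr hL
    rw [horiz_smul, norm_smul, norm_inv, norm_norm, inv_mul_le_iff₀ hL'] at h
    calc _ ≤ ‖L‖ * C := h
      _ ≤ max C 0 * ‖L‖ := by rw [mul_comm]; gcongr; exact le_max_left _ _

/-- The test functions built from `f` are only `C¹`; on a bounded set, uniform approximation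
together with first derivatives puts them in the Sobolev space. -/
theorem memW0_of_contDiff (H : HeisenbergType m k) (p : ℝ) {Ω : Set (Pt m k)}
    (hΩ : IsOpen Ω) (hb : Bornology.IsBounded Ω) {φ : Pt m k → ℝ} (hφ : ContDiff ℝ 1 φ)
    (hc : HasCompactSupport φ) (hs : tsupport φ ⊆ Ω) : MemW0 H p Ω φ (hgrad H φ) := by
  have hcg : HasCompactSupport (hgrad H φ) :=
    HasCompactSupport.intro hc fun x hx => hgrad_eq_zero_of_notMem_tsupport H hx
  have : IsFiniteMeasure (volume.restrict Ω) := ⟨by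
    simpa using hb.measure_lt_top⟩
  obtain ⟨C, hC0, hC⟩ := exists_norm_horiz_le H hb
  choose ψ hψ hψφ using fun n : ℕ =>
    exists_isTest_near hφ hc hΩ hs (ε := 1 / (n + 1 : ℝ)) (by positivity)
  have hlim : ∀ D : ℝ, Tendsto (fun n : ℕ =>
      volume.restrict Ω Set.univ ^ (ENNReal.ofReal p).toReal⁻¹ *
        ENNReal.ofReal (D * (1 / (n + 1 : ℝ)))) atTop (𝓝 0) := fun D => by
    have h1 := (tendsto_one_div_add_atTop_nhds_zero_nat (𝕜 := ℝ)).const_mul D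
    rw [mul_zero] at h1
    have h2 := ENNReal.tendsto_ofReal h1
    rw [ENNReal.ofReal_zero] at h2
    have h3 := ENNReal.Tendsto.const_mul h2
      (a := volume.restrict Ω Set.univ ^ (ENNReal.ofReal p).toReal⁻¹) (Or.inr (by finiteness))
    rwa [mul_zero] at h3
  refine ⟨(hφ.continuous.memLp_of_hasCompactSupport hc).restrict Ω,
    ((continuous_hgrad H hφ).memLp_of_hasCompactSupport hcg).restrict Ω, ψ, hψ, ?_, ?_⟩
  · refine tendsto_of_tendsto_of_tendsto_of_le_of_le tendsto_const_nhds (hlim 1)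
      (fun _ => zero_le) fun n => ?_
    refine eLpNorm_le_of_ae_bound (Eventually.of_forall fun x => ?_)
    simpa using (hψφ n x).1
  · refine tendsto_of_tendsto_of_tendsto_of_le_of_le tendsto_const_nhds (hlim C)
      (fun _ => zero_le) fun n => ?_
    refine eLpNorm_le_of_ae_bound ((ae_restrict_mem hΩ.measurableSet).mono fun x hx => ?_)
    rw [hgrad_eq_horiz H ((hψ n).1.differentiable (by simp) x),
      hgrad_eq_horiz H (hφ.differentiable one_ne_zero x), ← horiz_sub]
    refine (hC x hx _).trans ?_
    gcongr
    exact (hψφ n x).2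

/-! ### Integration by parts and identification of the weak horizontal gradient -/

/-- Left-invariant vector fields are divergence free. -/
theorem integral_fderiv_frameVec (H : HeisenbergType m k) {u : Pt m k → ℝ}
    (hu : ContDiff ℝ 1 u) (hc : HasCompactSupport u) (v : Pt m k) :
    ∫ x, fderiv ℝ u x (frameVec H v x) = 0 := by
  have hD : Continuous (fderiv ℝ u) := hu.continuous_fderiv one_ne_zero
  have hDc : HasCompactSupport (fderiv ℝ u) := hc.fderiv (𝕜 := ℝ)
  have hd : Differentiable ℝ u := hu.differentiable one_ne_zero
  have hc' : ∀ w, HasCompactSupport fun x => fderiv ℝ u x w := fun w =>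
    hDc.comp_left (g := fun L : Pt m k →L[ℝ] ℝ => L w) rfl
  -- In coordinates the field is a sum of coordinate fields with affine coefficients, each constant
  -- in its own direction (`a w = 0`): horizontal coefficients are constant, central ones depend on
  -- `z` only.
  have key : ∀ (a : Pt m k →L[ℝ] ℝ) (b : ℝ) (w : Pt m k), a w = 0 →
      ∫ x, (a x + b) * fderiv ℝ u x w = 0 := by
    intro a b w haw
    have ha : ∀ x, fderiv ℝ (fun x => a x + b) x = a := fun x => by simp
    have hwc : Continuous fun x => fderiv ℝ u x w := hD.clm_apply continuous_const
    have := integral_mul_fderiv_eq_neg_fderiv_mul_of_integrable (μ := volume)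
      (f := fun x => a x + b) (g := u) (v := w)
      (by simp [ha, haw])
      ((((a.continuous.add continuous_const).mul hwc)).integrable_of_hasCompactSupport
        ((hc' w).mul_left))
      (((a.continuous.add continuous_const).mul hu.continuous).integrable_of_hasCompactSupport
        hc.mul_left)
      (fun x _ => by fun_prop) (fun x _ => hd x)
    rw [this]
    simp [ha, haw]
  let A : Fin k → Pt m k →L[ℝ] ℝ := fun l => LinearMap.toContinuousLinearMap
    { toFun := fun x => (1 / 2 : ℝ) * H.bracket x.1 v.1 l
      map_add' := fun x y => by simp [mul_add]
      map_smul' := fun r x => by simp; ring }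
  have e : ∀ x, fderiv ℝ u x (frameVec H v x) = (∑ i, (0 + v.1 i) * fderiv ℝ u x (hBasis m k i)) +
      ∑ l, (A l x + v.2 l) * fderiv ℝ u x (vBasis m k l) := fun x => by
    conv_lhs => rw [sum_hBasis_add_sum_vBasis (frameVec H v x)]
    rw [map_add, map_sum, map_sum]
    simp only [map_smul, smul_eq_mul]
    refine congrArg₂ _ (Finset.sum_congr rfl fun i _ => ?_) (Finset.sum_congr rfl fun l _ => ?_)
    · rw [zero_add]; rfl
    · congr 1
      exact add_comm (v.2 l) _
  have hint : ∀ (a : Pt m k →L[ℝ] ℝ) (b : ℝ) (w : Pt m k),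
      Integrable fun x => (a x + b) * fderiv ℝ u x w := fun a b w =>
    ((a.continuous.add continuous_const).mul (hD.clm_apply
      continuous_const)).integrable_of_hasCompactSupport ((hc' w).mul_left)
  simp only [e]
  rw [integral_add, integral_finsetSum, integral_finsetSum, Finset.sum_eq_zero,
    Finset.sum_eq_zero, add_zero]
  · intro l _
    refine key _ _ _ ?_
    simp [A, vBasis]
  · intro i _
    exact key 0 _ _ rfl
  · exact fun l _ => hint _ _ _
  · exact fun i _ => hint 0 _ _
  · exact integrable_finsetSum _ fun i _ => hint 0 _ _
  · exact integrable_finsetSum _ fun l _ => hint _ _ _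

theorem contDiff_indicator {Ω K : Set (Pt m k)} (hΩ : IsOpen Ω) (hK : IsClosed K) (hKΩ : K ⊆ Ω)
    {u : Pt m k → ℝ} {n : ℕ∞ω} (hu : ContDiffOn ℝ n u Ω) (h0 : ∀ x ∈ Ω, x ∉ K → u x = 0) :
    ContDiff ℝ n (Ω.indicator u) := by
  rw [contDiff_iff_contDiffAt]
  intro x
  by_cases hx : x ∈ Ω
  · refine (hu.contDiffAt (hΩ.mem_nhds hx)).congr_of_eventuallyEq ?_
    filter_upwards [hΩ.mem_nhds hx] with y hy
    rw [Set.indicator_of_mem hy]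
  · have : Ω.indicator u =ᶠ[𝓝 x] fun _ => 0 := by
      filter_upwards [hK.isOpen_compl.mem_nhds fun h => hx (hKΩ h)] with y hy
      by_cases hyΩ : y ∈ Ω
      · rw [Set.indicator_of_mem hyΩ, h0 y hyΩ hy]
      · rw [Set.indicator_of_notMem hyΩ]
    exact contDiffAt_const.congr_of_eventuallyEq this

theorem tsupport_indicator_subset {Ω K : Set (Pt m k)} (hK : IsClosed K)
    {u : Pt m k → ℝ} (h0 : ∀ x ∈ Ω, x ∉ K → u x = 0) : tsupport (Ω.indicator u) ⊆ K := by
  refine closure_minimal (fun x hx => ?_) hK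
  by_contra hxK
  refine hx ?_
  by_cases hxΩ : x ∈ Ω
  · rw [Set.indicator_of_mem hxΩ, h0 x hxΩ hxK]
  · rw [Set.indicator_of_notMem hxΩ]

/-- Multiplication by a cutoff function extends a function on `Ω` by zero. -/
theorem contDiff_mul_of_tsupport_subset {Ω : Set (Pt m k)} (hΩ : IsOpen Ω)
    {g f : Pt m k → ℝ} {n : ℕ∞ω} (hg : ContDiff ℝ n g) (hs : tsupport g ⊆ Ω)
    (hf : ContDiffOn ℝ n f Ω) : ContDiff ℝ n fun x => g x * f x := by
  have e : (fun x => g x * f x) = Ω.indicator fun x => g x * f x := by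
    refine (Set.indicator_eq_self.mpr fun x hx => hs (subset_tsupport _ ?_)).symm
    exact left_ne_zero_of_mul hx
  rw [e]
  refine contDiff_indicator hΩ (isClosed_tsupport g) hs (hg.contDiffOn.mul hf) fun x _ hx => ?_
  rw [image_eq_zero_of_notMem_tsupport hx, zero_mul]

theorem tendsto_integral_mul_of_tendsto_eLpNorm {E : Type*} [MeasurableSpace E] {μ : Measure E}
    [IsFiniteMeasure μ] {p : ℝ} (hp : 1 ≤ p) {a : ℕ → E → ℝ} {b g : E → ℝ} {C : ℝ}
    (ha : ∀ n, MemLp (a n) (ENNReal.ofReal p) μ) (hb : MemLp b (ENNReal.ofReal p) μ)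
    (hg : AEStronglyMeasurable g μ) (hgC : ∀ x, |g x| ≤ C)
    (h : Tendsto (fun n => eLpNorm (fun x => a n x - b x) (ENNReal.ofReal p) μ) atTop (𝓝 0)) :
    Tendsto (fun n => ∫ x, g x * a n x ∂μ) atTop (𝓝 (∫ x, g x * b x ∂μ)) := by
  have hp' : (1 : ENNReal) ≤ ENNReal.ofReal p := by simpa using ENNReal.ofReal_le_ofReal hp
  have hi : ∀ c : E → ℝ, MemLp c (ENNReal.ofReal p) μ → Integrable (fun x => g x * c x) μ :=
    fun c hc => (hc.integrable hp').bdd_mul hg (Eventually.of_forall hgC)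
  refine tendsto_integral_of_L1' _ (hi b hb).1 (Eventually.of_forall fun n => hi _ (ha n)) ?_
  set D := μ Set.univ ^ (1 / (1 : ENNReal).toReal - 1 / (ENNReal.ofReal p).toReal)
  have hD : D ≠ ⊤ := by
    refine ENNReal.rpow_ne_top_of_nonneg ?_ (measure_ne_top _ _)
    rw [ENNReal.toReal_ofReal (by linarith), ENNReal.toReal_one, sub_nonneg]
    exact one_div_le_one_div_of_le one_pos hp
  have h3 : Tendsto (fun n => ENNReal.ofReal C *
      (eLpNorm (fun x => a n x - b x) (ENNReal.ofReal p) μ * D)) atTop (𝓝 0) := by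
    have h1 := ENNReal.Tendsto.mul_const h (b := D) (Or.inr hD)
    rw [zero_mul] at h1
    have h2 := ENNReal.Tendsto.const_mul h1 (a := ENNReal.ofReal C) (Or.inr ENNReal.ofReal_ne_top)
    rwa [mul_zero] at h2
  refine tendsto_of_tendsto_of_tendsto_of_le_of_le tendsto_const_nhds h3 (fun _ => zero_le)
    fun n => ?_
  have hm : AEStronglyMeasurable (fun x => a n x - b x) μ := (ha n).1.sub hb.1
  refine le_trans ?_ (mul_le_mul_right (eLpNorm_le_eLpNorm_mul_rpow_measure_univ hp' hm) _)
  refine eLpNorm_le_mul_eLpNorm_of_ae_le_mul (Eventually.of_forall fun x => ?_) 1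
  simp only [Pi.sub_apply, ← mul_sub, norm_mul]
  gcongr
  exact hgC x

theorem integral_mul_fderiv_frameVec (H : HeisenbergType m k) {Ω : Set (Pt m k)} (hΩ : IsOpen Ω)
    {f g : Pt m k → ℝ} (hf : ContDiffOn ℝ 1 f Ω) (hg : ContDiff ℝ 1 g) (hc : HasCompactSupport g)
    (hs : tsupport g ⊆ Ω) (v : Pt m k) :
    ∫ x in Ω, g x * fderiv ℝ f x (frameVec H v x) =
      -∫ x in Ω, f x * fderiv ℝ g x (frameVec H v x) := by
  have hgf : ContDiff ℝ 1 fun x => g x * f x := contDiff_mul_of_tsupport_subset hΩ hg hs hf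
  have h0 := integral_fderiv_frameVec H hgf hc.mul_right v
  have hD : ContinuousOn (fderiv ℝ f) Ω := hf.continuousOn_fderiv_of_isOpen hΩ le_rfl
  have hfr : Continuous (frameVec H v) := (contDiff_frameVec H v).continuous
  have hint : ∀ a : Pt m k → ℝ, ContinuousOn a Ω → tsupport a ⊆ tsupport g →
      IntegrableOn a Ω := fun a ha hsa => by
    have h1 : IntegrableOn a (tsupport g) :=
      (ha.mono hs).integrableOn_compact hc.isCompact
    refine (integrableOn_iff_integrable_of_support_subset ?_).mp h1 |>.integrableOn
    exact (subset_tsupport a).trans hsa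
  have i1 : IntegrableOn (fun x => g x * fderiv ℝ f x (frameVec H v x)) Ω :=
    hint _ (hg.continuous.continuousOn.mul (hD.clm_apply hfr.continuousOn))
      (closure_mono fun x hx => left_ne_zero_of_mul hx)
  have i2 : IntegrableOn (fun x => f x * fderiv ℝ g x (frameVec H v x)) Ω :=
    hint _ (hf.continuousOn.mul ((hg.continuous_fderiv one_ne_zero).clm_apply hfr).continuousOn)
      (closure_minimal (fun x hx => by
        by_contra hxg
        exact hx (by simp [fderiv_of_notMem_tsupport ℝ hxg])) isClosed_closure)
  have h1 : ∫ x in Ω, fderiv ℝ (fun x => g x * f x) x (frameVec H v x) = 0 := by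
    refine (setIntegral_eq_integral_of_forall_compl_eq_zero fun x hx => ?_).trans h0
    rw [fderiv_of_notMem_tsupport ℝ fun h =>
      hx (hs (closure_mono (fun y hy => left_ne_zero_of_mul hy) h))]
    rfl
  rw [eq_neg_iff_add_eq_zero, ← integral_add i1 i2, ← h1]
  refine setIntegral_congr_fun hΩ.measurableSet fun x hx => ?_
  have hfx : DifferentiableAt ℝ f x :=
    (hf.differentiableOn one_ne_zero).differentiableAt (hΩ.mem_nhds hx)
  rw [fderiv_fun_mul (hg.differentiable one_ne_zero x) hfx]
  simp

/-- Both `F` and the classical gradient satisfy the same integration by parts formula against test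
functions, the former by passing to the limit in the approximating sequence. The fundamental lemma
of the calculus of variations identifies them. -/
theorem MemW0.ae_eq_hgrad {H : HeisenbergType m k} {p : ℝ} (hp : 1 < p) {Ω : Set (Pt m k)}
    (hΩ : IsOpen Ω) (hb : Bornology.IsBounded Ω) {f : Pt m k → ℝ}
    {F : Pt m k → EuclideanSpace ℝ (Fin m)} (h : MemW0 H p Ω f F) (hf : ContDiffOn ℝ 1 f Ω) :
    ∀ᵐ x ∂volume.restrict Ω, F x = hgrad H f x := by
  obtain ⟨hfp, hFp, φ, hφ, hφf, hφF⟩ := h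
  have : IsFiniteMeasure (volume.restrict Ω) := ⟨by simpa using hb.measure_lt_top⟩
  have hp' : (1 : ENNReal) ≤ ENNReal.ofReal p := by simpa using ENNReal.ofReal_le_ofReal hp.le
  have hdf : ∀ x ∈ Ω, DifferentiableAt ℝ f x := fun x hx =>
    (hf.differentiableOn one_ne_zero).differentiableAt (hΩ.mem_nhds hx)
  have hDf : ContinuousOn (fderiv ℝ f) Ω := hf.continuousOn_fderiv_of_isOpen hΩ le_rfl
  suffices hi : ∀ i, ∀ᵐ x, x ∈ Ω → F x i - fderiv ℝ f x (frameVec H (hBasis m k i) x) = 0 by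
    rw [ae_restrict_iff' hΩ.measurableSet]
    filter_upwards [ae_all_iff.mpr hi] with x hx hxΩ
    ext i
    rw [hgrad_eq_horiz H (hdf x hxΩ)]
    exact sub_eq_zero.mp (hx i hxΩ)
  intro i
  have hv : Continuous (frameVec H (hBasis m k i)) := (contDiff_frameVec H _).continuous
  have hFi : MemLp (fun x => F x i) (ENNReal.ofReal p) (volume.restrict Ω) := by
    refine hFp.of_le ((EuclideanSpace.proj i : EuclideanSpace ℝ (Fin m) →L[ℝ]
      ℝ).continuous.comp_aestronglyMeasurable hFp.1) (Eventually.of_forall fun x => ?_)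
    exact PiLp.norm_apply_le (F x) i
  have hXf : ContinuousOn (fun x => fderiv ℝ f x (frameVec H (hBasis m k i) x)) Ω :=
    hDf.clm_apply hv.continuousOn
  refine IsOpen.ae_eq_zero_of_integral_contDiff_smul_eq_zero hΩ ?_ fun g hg hgc hgs => ?_
  · exact (IntegrableOn.locallyIntegrableOn (hFi.integrable hp')).sub
      (hXf.locallyIntegrableOn hΩ.measurableSet)
  obtain ⟨C, hC⟩ := hgc.exists_bound_of_continuous hg.continuous
  obtain ⟨C', hC'⟩ : ∃ C', ∀ x, ‖fderiv ℝ g x (frameVec H (hBasis m k i) x)‖ ≤ C' := by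
    refine HasCompactSupport.exists_bound_of_continuous (HasCompactSupport.intro hgc fun x hx => ?_)
      ((hg.continuous_fderiv (by simp)).clm_apply hv)
    rw [fderiv_of_notMem_tsupport ℝ hx]; rfl
  have hφd : ∀ n, ContDiff ℝ 1 (φ n) := fun n => (hφ n).1.of_le (by simp)
  have hg1 : ContDiff ℝ 1 g := hg.of_le (by simp)
  have hφp : ∀ n, MemLp (φ n) (ENNReal.ofReal p) (volume.restrict Ω) := fun n =>
    ((hφd n).continuous.memLp_of_hasCompactSupport (hφ n).2.1).restrict Ω
  have hXφ : ∀ n x, (hgrad H (φ n) x) i = fderiv ℝ (φ n) x (frameVec H (hBasis m k i) x) :=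
    fun n x => by
      rw [hgrad_eq_horiz H ((hφd n).differentiable one_ne_zero x)]; rfl
  have hXφp : ∀ n, MemLp (fun x => hgrad H (φ n) x i) (ENNReal.ofReal p) (volume.restrict Ω) :=
    fun n => by
      have hcg : HasCompactSupport fun x => hgrad H (φ n) x i :=
        HasCompactSupport.intro (hφ n).2.1 fun x hx => by
          rw [hgrad_eq_zero_of_notMem_tsupport H hx]; rfl
      refine (Continuous.memLp_of_hasCompactSupport ?_ hcg).restrict Ω
      exact (EuclideanSpace.proj i : EuclideanSpace ℝ (Fin m) →L[ℝ] ℝ).continuous.comp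
        (continuous_hgrad H (hφd n))
  have t1 : Tendsto (fun n => ∫ x in Ω, g x * hgrad H (φ n) x i) atTop
      (𝓝 (∫ x in Ω, g x * F x i)) := by
    refine tendsto_integral_mul_of_tendsto_eLpNorm hp.le hXφp hFi
      hg.continuous.aestronglyMeasurable hC ?_
    refine tendsto_of_tendsto_of_tendsto_of_le_of_le tendsto_const_nhds hφF (fun _ => zero_le)
      fun n => eLpNorm_mono fun x => ?_
    exact PiLp.norm_apply_le (hgrad H (φ n) x - F x) i
  have t2 : Tendsto (fun n => ∫ x in Ω, fderiv ℝ g x (frameVec H (hBasis m k i) x) * φ n x) atTop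
      (𝓝 (∫ x in Ω, fderiv ℝ g x (frameVec H (hBasis m k i) x) * f x)) :=
    tendsto_integral_mul_of_tendsto_eLpNorm hp.le hφp hfp
      ((hg.continuous_fderiv (by simp)).clm_apply hv).aestronglyMeasurable hC' hφf
  have e1 : ∀ n, ∫ x in Ω, g x * hgrad H (φ n) x i =
      -∫ x in Ω, fderiv ℝ g x (frameVec H (hBasis m k i) x) * φ n x := fun n => by
    simp only [hXφ]
    rw [integral_mul_fderiv_frameVec H hΩ (hφd n).contDiffOn hg1 hgc hgs]
    simp only [mul_comm]
  have e2 := integral_mul_fderiv_frameVec H hΩ hf hg1 hgc hgs (hBasis m k i)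
  simp only [e1] at t1
  have e3 := tendsto_nhds_unique t1 t2.neg
  have hgb : AEStronglyMeasurable g (volume.restrict Ω) := hg.continuous.aestronglyMeasurable
  have i1 : IntegrableOn (fun x => g x * F x i) Ω :=
    (hFi.integrable hp').bdd_mul hgb (Eventually.of_forall hC)
  have i2 : IntegrableOn (fun x => g x * fderiv ℝ f x (frameVec H (hBasis m k i) x)) Ω := by
    have h1 : IntegrableOn (fun x => g x * fderiv ℝ f x (frameVec H (hBasis m k i) x))
        (tsupport g) :=
      ((hg.continuous.continuousOn.mul hXf).mono hgs).integrableOn_compact hgc.isCompact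
    refine (integrableOn_iff_integrable_of_support_subset ?_).mp h1 |>.integrableOn
    exact fun x hx => subset_tsupport g (left_ne_zero_of_mul hx)
  rw [← setIntegral_eq_integral_of_forall_compl_eq_zero (s := Ω)]
  · simp only [smul_eq_mul, mul_sub]
    rw [integral_sub i1 i2, e3, e2]
    simp only [mul_comm]
    ring
  · intro x hx
    rw [image_eq_zero_of_notMem_tsupport fun h => hx (hgs h), zero_smul]

/-! ### Dilations and the Pohozaev identity -/

/-- The dilation `(z, σ) ↦ (r z, r² σ)`. -/
def dil (r : ℝ) (x : Pt m k) : Pt m k := (r • x.1, r ^ 2 • x.2)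

/-- The generator of the dilations. -/
def euler (x : Pt m k) : Pt m k := (x.1, (2 : ℝ) • x.2)

@[simp] theorem dil_one (x : Pt m k) : dil 1 x = x := by simp [dil]

theorem dil_dil (r s : ℝ) (x : Pt m k) : dil r (dil s x) = dil (r * s) x := by
  simp [dil, smul_smul, mul_pow]

theorem continuous_dil : Continuous fun q : ℝ × Pt m k => dil q.1 q.2 := by
  unfold dil
  fun_prop

theorem continuous_dil_right (r : ℝ) : Continuous (dil r : Pt m k → Pt m k) :=
  continuous_dil.comp (Continuous.prodMk_right r)

theorem contDiff_dil (r : ℝ) : ContDiff ℝ ∞ (dil r : Pt m k → Pt m k) := by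
  unfold dil
  fun_prop

theorem continuous_euler : Continuous (euler : Pt m k → Pt m k) := by
  unfold euler
  fun_prop

theorem hasDerivAt_dil (x : Pt m k) (r : ℝ) :
    HasDerivAt (fun r => dil r x) (x.1, (2 * r) • x.2) r := by
  refine HasDerivAt.prodMk ?_ ?_
  · simpa using (hasDerivAt_id r).smul_const x.1
  · simpa using (hasDerivAt_pow 2 r).smul_const x.2

theorem dil_curve_hBasis (H : HeisenbergType m k) (r t : ℝ) (i : Fin m) (x : Pt m k) :
    dil r (curve H (hBasis m k i) x t) = curve H (hBasis m k i) (dil r x) (r * t) := by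
  ext1
  · simp [dil, curve, mul, hBasis, smul_add, smul_smul]
  · simp only [dil, curve, mul, hBasis, Prod.smul_fst, Prod.smul_snd, map_smul, smul_zero,
      add_zero, LinearMap.smul_apply]
    module

theorem hgrad_comp_dil (H : HeisenbergType m k) (f : Pt m k → ℝ) (r : ℝ) (x : Pt m k) :
    hgrad H (fun x => f (dil r x)) x = r • hgrad H f (dil r x) := by
  ext i
  simp only [hgrad, X, lieDeriv, dil_curve_hBasis, PiLp.smul_apply]
  rw [deriv_comp_mul_left r (fun t => f (curve H (hBasis m k i) (dil r x) t)) 0, mul_zero]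

theorem hgrad_mul (H : HeisenbergType m k) {f g : Pt m k → ℝ} {x : Pt m k}
    (hf : DifferentiableAt ℝ f x) (hg : DifferentiableAt ℝ g x) :
    hgrad H (fun x => f x * g x) x = f x • hgrad H g x + g x • hgrad H f x := by
  rw [hgrad_eq_horiz H (hf.fun_mul hg), fderiv_fun_mul hf hg, horiz_add, horiz_smul, horiz_smul,
    hgrad_eq_horiz H hf, hgrad_eq_horiz H hg]

theorem hgrad_sub (H : HeisenbergType m k) {f g : Pt m k → ℝ} {x : Pt m k}
    (hf : DifferentiableAt ℝ f x) (hg : DifferentiableAt ℝ g x) :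
    hgrad H (fun x => f x - g x) x = hgrad H f x - hgrad H g x := by
  rw [hgrad_eq_horiz H (hf.fun_sub hg), fderiv_fun_sub hf hg, horiz_sub,
    hgrad_eq_horiz H hf, hgrad_eq_horiz H hg]

theorem integral_comp_dil {u : Pt m k → ℝ} (hu : Continuous u) {r : ℝ} (hr : 0 < r) :
    ∫ x, u (dil r x) = (r ^ (m + 2 * k))⁻¹ * ∫ x, u x := by
  have hmap : Measure.map (dil r) (volume : Measure (Pt m k)) =
      ENNReal.ofReal (r ^ (m + 2 * k))⁻¹ • volume := by
    have h1 := Measure.map_addHaar_smul (volume : Measure (EuclideanSpace ℝ (Fin m))) hr.ne'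
    have h2 := Measure.map_addHaar_smul (volume : Measure (EuclideanSpace ℝ (Fin k)))
      (pow_pos hr 2).ne'
    have h3 := Measure.map_prod_map (volume : Measure (EuclideanSpace ℝ (Fin m)))
      (volume : Measure (EuclideanSpace ℝ (Fin k)))
      (measurable_const_smul r) (measurable_const_smul (r ^ 2))
    rw [h1, h2, Measure.prod_smul_left, Measure.prod_smul_right, smul_smul] at h3
    change Measure.map (Prod.map (r • ·) (r ^ 2 • ·)) ((volume : Measure
      (EuclideanSpace ℝ (Fin m))).prod (volume : Measure (EuclideanSpace ℝ (Fin k)))) = _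
    rw [← h3, ← ENNReal.ofReal_mul (abs_nonneg _), abs_of_pos (by positivity),
      abs_of_pos (by positivity), finrank_euclideanSpace_fin, finrank_euclideanSpace_fin,
      ← mul_inv, ← pow_mul, ← pow_add]
    rfl
  have := integral_map (μ := (volume : Measure (Pt m k))) (φ := dil r)
    (continuous_dil_right r).aemeasurable hu.aestronglyMeasurable
  rw [← this, hmap, integral_smul_measure, ENNReal.toReal_ofReal (by positivity), smul_eq_mul]

theorem hasDerivAt_integral_mul_comp_dil {w u : Pt m k → ℝ} (hw : Continuous w)
    (hu : ContDiff ℝ 1 u) (hc : HasCompactSupport u) :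
    HasDerivAt (fun r => ∫ x, w x * u (dil r x)) (∫ x, w x * fderiv ℝ u x (euler x)) 1 := by
  have hD : Continuous (fderiv ℝ u) := hu.continuous_fderiv one_ne_zero
  obtain ⟨R, hR⟩ := hc.isCompact.isBounded.subset_closedBall (0 : Pt m k)
  let S : Set ℝ := Set.Icc (1 / 2) 2
  have hS : S ∈ 𝓝 (1 : ℝ) := Icc_mem_nhds (by norm_num) (by norm_num)
  -- For `r ≥ 1/2` the central coordinate is shrunk by at most `1/4`, whence the radius `4 * R`,
  -- uniform in `r ∈ S`.
  have hsupp : ∀ r ∈ S, ∀ x, dil r x ∈ tsupport u → x ∈ Metric.closedBall (0 : Pt m k) (4 * R) := by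
    intro r hr x hx
    have hr0 : (0 : ℝ) < r := lt_of_lt_of_le (by norm_num) hr.1
    have h := hR hx
    rw [mem_closedBall_zero_iff, Prod.norm_def, max_le_iff] at h ⊢
    have h1 : r * ‖x.1‖ ≤ R := by
      have := h.1
      rwa [dil, norm_smul, Real.norm_of_nonneg hr0.le] at this
    have h2 : r ^ 2 * ‖x.2‖ ≤ R := by
      have := h.2
      rwa [dil, norm_smul, Real.norm_of_nonneg (by positivity)] at this
    have e1 : (1 / 2) * ‖x.1‖ ≤ R := (by gcongr; exact hr.1 : _ ≤ r * ‖x.1‖).trans h1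
    have e2 : (1 / 2) ^ 2 * ‖x.2‖ ≤ R := (by gcongr; exact hr.1 : _ ≤ r ^ 2 * ‖x.2‖).trans h2
    have n1 := norm_nonneg x.1
    have n2 := norm_nonneg x.2
    constructor <;> linarith
  let F' : ℝ → Pt m k → ℝ := fun r x => w x * fderiv ℝ u (dil r x) (x.1, (2 * r) • x.2)
  have hF'c : Continuous fun q : ℝ × Pt m k => F' q.1 q.2 := by
    have h1 : Continuous fun q : ℝ × Pt m k => ((q.2.1, (2 * q.1) • q.2.2) : Pt m k) := by fun_prop
    exact (hw.comp continuous_snd).mul ((hD.comp continuous_dil).clm_apply h1)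
  obtain ⟨C, hC⟩ := (isCompact_Icc.prod (isCompact_closedBall (0 : Pt m k)
    (4 * R))).exists_bound_of_continuousOn (s := S ×ˢ Metric.closedBall (0 : Pt m k) (4 * R))
    hF'c.continuousOn
  have hF'1 : F' 1 = fun x => w x * fderiv ℝ u x (euler x) := by
    funext x
    simp [F', euler]
  rw [← hF'1]
  refine (hasDerivAt_integral_of_dominated_loc_of_deriv_le (F' := F')
    (bound := (Metric.closedBall (0 : Pt m k) (4 * R)).indicator fun _ => C) hS
    (Eventually.of_forall fun r =>
      (hw.mul (hu.continuous.comp (continuous_dil_right r))).aestronglyMeasurable)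
    ?_ (hF'c.comp (Continuous.prodMk_right 1)).aestronglyMeasurable
    (Eventually.of_forall fun x r hr => ?_) ?_ (Eventually.of_forall fun x r _ => ?_)).2
  · change Integrable (fun x => w x * u (dil 1 x)) volume
    simp only [dil_one]
    exact (hw.mul hu.continuous).integrable_of_hasCompactSupport hc.mul_left
  · by_cases hx : x ∈ Metric.closedBall (0 : Pt m k) (4 * R)
    · rw [Set.indicator_of_mem hx]
      exact hC (r, x) ⟨hr, hx⟩
    · rw [Set.indicator_of_notMem hx]
      simp only [F']
      rw [fderiv_of_notMem_tsupport ℝ fun h => hx (hsupp r hr x h)]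
      simp
  · exact (integrable_indicator_iff Metric.isClosed_closedBall.measurableSet).mpr
      (integrableOn_const (isCompact_closedBall _ _).measure_lt_top.ne)
  · exact ((hu.differentiable one_ne_zero _).hasFDerivAt.comp_hasDerivAt r
      (hasDerivAt_dil x r)).const_mul _

theorem homDim_eq (m k : ℕ) : homDim m k = ((m + 2 * k : ℕ) : ℝ) := by
  simp [homDim]

/-- The divergence of `|z|^p Z` is `(Q + p) |z|^p`. Instead of integrating by parts, differentiate
at `r = 1` the scaling law `∫ |z|^p u(dil r x) = r^{-(Q+p)} ∫ |z|^p u`. -/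
theorem integral_norm_rpow_mul_fderiv_euler {p : ℝ} (hp : 0 < p) {u : Pt m k → ℝ}
    (hu : ContDiff ℝ 1 u) (hc : HasCompactSupport u) :
    ∫ x, ‖x.1‖ ^ p * fderiv ℝ u x (euler x) = -(homDim m k + p) * ∫ x, ‖x.1‖ ^ p * u x := by
  have hw : Continuous fun x : Pt m k => ‖x.1‖ ^ p :=
    (continuous_norm.comp continuous_fst).rpow_const fun _ => Or.inr hp.le
  have h1 := hasDerivAt_integral_mul_comp_dil hw hu hc
  have h2 : HasDerivAt (fun r : ℝ => r ^ (-(homDim m k + p)) * ∫ x, ‖x.1‖ ^ p * u x)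
      (-(homDim m k + p) * ∫ x, ‖x.1‖ ^ p * u x) 1 := by
    have := (Real.hasDerivAt_rpow_const (x := 1) (p := -(homDim m k + p))
      (Or.inl one_ne_zero)).mul_const (∫ x, ‖x.1‖ ^ p * u x)
    simpa using this
  refine h1.unique (h2.congr_of_eventuallyEq ?_)
  filter_upwards [lt_mem_nhds (show (0 : ℝ) < 1 by norm_num)] with r hr
  have h3 := integral_comp_dil (hw.mul hu.continuous) hr
  simp only [Pi.mul_apply] at h3
  have h4 : ∀ x : Pt m k, ‖(dil r x).1‖ ^ p * u (dil r x) = r ^ p * (‖x.1‖ ^ p * u (dil r x)) :=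
    fun x => by
      rw [dil, norm_smul, Real.norm_of_nonneg hr.le, Real.mul_rpow hr.le (norm_nonneg _)]
      ring
  simp only [h4, integral_const_mul] at h3
  rw [neg_add, Real.rpow_add hr, Real.rpow_neg hr.le, Real.rpow_neg hr.le, homDim_eq,
    Real.rpow_natCast]
  have := (Real.rpow_pos_of_pos hr p).ne'
  rw [← mul_right_inj' this, h3]
  field_simp

/-- The convex function `|·|^p` lies above its tangent at `a`. Cauchy-Schwarz reduces this to
Young's inequality with exponents `p/(p-1)` and `p`. -/
theorem rpow_norm_sub_le {E : Type*} [NormedAddCommGroup E] [InnerProductSpace ℝ E] {p : ℝ}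
    (hp : 1 < p) (a b : E) :
    p * (‖a‖ ^ (p - 2) * inner ℝ a (b - a)) ≤ ‖b‖ ^ p - ‖a‖ ^ p := by
  have hp0 : 0 < p := by linarith
  rcases eq_or_ne a 0 with rfl | ha
  · rw [inner_zero_left, mul_zero, mul_zero, norm_zero, Real.zero_rpow hp0.ne', sub_zero]
    positivity
  · have ha' : 0 < ‖a‖ := norm_pos_iff.mpr ha
    have e1 : ‖a‖ ^ (p - 2) * ‖a‖ ^ 2 = ‖a‖ ^ p := by
      rw [← Real.rpow_natCast ‖a‖ 2, ← Real.rpow_add ha']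
      congr 1
      push_cast
      ring
    have e2 : ‖a‖ ^ (p - 2) * ‖a‖ = ‖a‖ ^ (p - 1) := by
      conv_lhs => rw [← Real.rpow_one ‖a‖, ← Real.rpow_mul ha'.le, ← Real.rpow_add ha']
      congr 1
      ring
    have hpq : (p / (p - 1)).HolderConjugate p :=
      (Real.HolderConjugate.conjExponent hp).symm
    have hy := Real.young_inequality_of_nonneg (Real.rpow_nonneg ha'.le (p - 1))
      (norm_nonneg b) hpq
    rw [← Real.rpow_mul ha'.le, mul_div_cancel₀ _ (by linarith : p - 1 ≠ 0)] at hy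
    have h3 : ‖a‖ ^ (p - 2) * inner ℝ a b ≤ ‖a‖ ^ (p - 1) * ‖b‖ := by
      rw [← e2, mul_assoc]
      gcongr
      exact real_inner_le_norm a b
    rw [inner_sub_right, real_inner_self_eq_norm_sq, mul_sub, e1]
    have h4 := mul_le_mul_of_nonneg_left (h3.trans hy) hp0.le
    have h5 : p * (‖a‖ ^ p / (p / (p - 1)) + ‖b‖ ^ p / p) = (p - 1) * ‖a‖ ^ p + ‖b‖ ^ p := by
      have : p - 1 ≠ 0 := by linarith
      field_simp
    linarith

/-- The expression is `p⁻¹` times the differential of `|·|^p`, which is `C¹` for `p > 1`; this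
covers the apparent singularity at `0` when `p < 2`. -/
theorem continuous_rpow_norm_smul {E : Type*} [NormedAddCommGroup E] [InnerProductSpace ℝ E]
    {p : ℝ} (hp : 1 < p) : Continuous fun q : E × E => ‖q.1‖ ^ (p - 2) * inner ℝ q.1 q.2 := by
  have h : Continuous fun x : E => fderiv ℝ (fun x : E => ‖x‖ ^ p) x :=
    (contDiff_norm_rpow hp).continuous_fderiv one_ne_zero
  have h2 := (h.comp continuous_fst).clm_apply (continuous_snd (X := E) (Y := E))
  have e : (fun q : E × E => ‖q.1‖ ^ (p - 2) * inner ℝ q.1 q.2) =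
      fun q => p⁻¹ * fderiv ℝ (fun x : E => ‖x‖ ^ p) q.1 q.2 := by
    funext q
    rw [fderiv_norm_rpow q.1 hp]
    simp only [smul_apply, innerSL_apply_apply, smul_eq_mul]
    field_simp
  rw [e]
  exact continuous_const.mul h2

/-- Pohozaev identity for the dilations. Only first derivatives of `g` occur: it is the
stationarity at `r = 1` of a function of the dilation parameter `r` that is minimal there by
convexity. -/
theorem dilation_identity (H : HeisenbergType m k) {p : ℝ} (hp : 1 < p) {g θ w : Pt m k → ℝ}
    (hg : ContDiff ℝ 1 g) (hgc : HasCompactSupport g) (hθ : ContDiff ℝ 1 θ)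
    (hθc : HasCompactSupport θ) (hθ0 : ∀ x, 0 ≤ θ x) (hw : Continuous w)
    (hweak : ∀ φ, ContDiff ℝ 1 φ → tsupport φ ⊆ tsupport θ →
      ∫ x, ‖hgrad H g x‖ ^ (p - 2) * inner ℝ (hgrad H g x) (hgrad H φ x) = ∫ x, w x * φ x) :
    (∫ x, ‖hgrad H g x‖ ^ (p - 2) * inner ℝ (hgrad H g x) (hgrad H θ x) *
        fderiv ℝ g x (euler x)) +
      p⁻¹ * ((p - homDim m k) * (∫ x, ‖hgrad H g x‖ ^ p * θ x) -
        ∫ x, ‖hgrad H g x‖ ^ p * fderiv ℝ θ x (euler x)) =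
      ∫ x, w x * θ x * fderiv ℝ g x (euler x) := by
  have hp0 : 0 < p := by linarith
  have hG : Continuous (hgrad H g) := continuous_hgrad H hg
  have hA : Continuous fun x => ‖hgrad H g x‖ ^ (p - 2) * inner ℝ (hgrad H g x) (hgrad H θ x) :=
    (continuous_rpow_norm_smul hp).comp (hG.prodMk (continuous_hgrad H hθ))
  have hE : Continuous fun x => ‖hgrad H g x‖ ^ p :=
    hG.norm.rpow_const fun _ => Or.inr hp0.le
  set A := fun x => ‖hgrad H g x‖ ^ (p - 2) * inner ℝ (hgrad H g x) (hgrad H θ x) with hAdef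
  set E := fun x => ‖hgrad H g x‖ ^ p with hEdef
  -- The middle term is `p⁻¹ ∫ θ |∇_H (g ∘ dil r)|^p` after a change of variables. In this form the
  -- parameter `r` acts on `θ` and not on the gradient of `g`, so differentiating in `r` needs no
  -- second derivatives.
  let N : ℝ → ℝ := fun r => (∫ x, A x * g (dil r x)) +
    p⁻¹ * (r ^ (p - homDim m k) * ∫ x, E x * θ (dil r⁻¹ x)) - ∫ x, w x * θ x * g (dil r x)
  have hder : HasDerivAt N ((∫ x, A x * fderiv ℝ g x (euler x)) +
      p⁻¹ * ((p - homDim m k) * (∫ x, E x * θ x) - ∫ x, E x * fderiv ℝ θ x (euler x)) -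
      ∫ x, w x * θ x * fderiv ℝ g x (euler x)) 1 := by
    have h1 := hasDerivAt_integral_mul_comp_dil hA hg hgc
    have h2 := hasDerivAt_integral_mul_comp_dil (hw.mul hθ.continuous) hg hgc
    have h3 := hasDerivAt_integral_mul_comp_dil hE hθ hθc
    rw [← inv_one] at h3
    have h4 := HasDerivAt.comp (1 : ℝ) h3 (hasDerivAt_inv one_ne_zero)
    have h5 := (Real.hasDerivAt_rpow_const (x := 1) (p := p - homDim m k)
      (Or.inl one_ne_zero)).mul h4
    have h6 := (h1.add (h5.const_mul p⁻¹)).sub h2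
    refine h6.congr_deriv ?_
    simp only [Real.one_rpow, Function.comp_apply, inv_one, dil_one, Pi.mul_apply]
    ring
  have hmin : IsLocalMin N 1 := by
    filter_upwards [lt_mem_nhds (show (0 : ℝ) < 1 by norm_num)] with r hr
    -- A difference quotient version of the test function `θ Z g`. The weak equation for it, with
    -- the tangent inequality weighted by `θ ≥ 0`, reads `N 1 ≤ N r`.
    let φ : Pt m k → ℝ := fun x => θ x * (g (dil r x) - g x)
    have hgr : ContDiff ℝ 1 fun x => g (dil r x) :=
      hg.comp ((contDiff_dil r).of_le (by simp))
    have hφ : ContDiff ℝ 1 φ := hθ.mul (hgr.sub hg)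
    have hφs : tsupport φ ⊆ tsupport θ := closure_mono fun x hx => left_ne_zero_of_mul hx
    have hw1 := hweak φ hφ hφs
    have hgrφ : ∀ x, hgrad H φ x = θ x • (r • hgrad H g (dil r x) - hgrad H g x) +
        (g (dil r x) - g x) • hgrad H θ x := fun x => by
      have d1 := hgr.differentiable one_ne_zero x
      have d2 := hg.differentiable one_ne_zero x
      rw [hgrad_mul H (hθ.differentiable one_ne_zero x) (d1.fun_sub d2), hgrad_sub H d1 d2,
        hgrad_comp_dil]
    have hGr : Continuous fun x => r • hgrad H g (dil r x) :=
      (hG.comp (continuous_dil_right r)).const_smul r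
    have hθA : ∀ x, x ∉ tsupport θ → A x = 0 := fun x hx => by
      simp [hAdef, hgrad_eq_zero_of_notMem_tsupport H hx]
    have hAc : HasCompactSupport A := HasCompactSupport.intro hθc hθA
    have i1 : Integrable fun x => A x * g (dil r x) :=
      (hA.mul hgr.continuous).integrable_of_hasCompactSupport hAc.mul_right
    have i2 : Integrable fun x => A x * g x :=
      (hA.mul hg.continuous).integrable_of_hasCompactSupport hAc.mul_right
    have i3 : Integrable fun x => w x * θ x * g (dil r x) :=
      ((hw.mul hθ.continuous).mul hgr.continuous).integrable_of_hasCompactSupport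
        hθc.mul_left.mul_right
    have i4 : Integrable fun x => w x * θ x * g x :=
      ((hw.mul hθ.continuous).mul hg.continuous).integrable_of_hasCompactSupport
        hθc.mul_left.mul_right
    have i5 : Integrable fun x => θ x * (‖hgrad H g x‖ ^ (p - 2) *
        inner ℝ (hgrad H g x) (r • hgrad H g (dil r x) - hgrad H g x)) :=
      (hθ.continuous.mul ((continuous_rpow_norm_smul hp).comp
        (hG.prodMk (hGr.sub hG)))).integrable_of_hasCompactSupport hθc.mul_right
    have i6 : Integrable fun x => θ x * ‖r • hgrad H g (dil r x)‖ ^ p :=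
      (hθ.continuous.mul (hGr.norm.rpow_const fun _ =>
        Or.inr hp0.le)).integrable_of_hasCompactSupport hθc.mul_right
    have i7 : Integrable fun x => θ x * E x :=
      (hθ.continuous.mul hE).integrable_of_hasCompactSupport hθc.mul_right
    have i12 : Integrable fun x => A x * g (dil r x) - A x * g x := i1.sub i2
    have e1 : (∫ x, A x * g (dil r x)) - (∫ x, A x * g x) +
        (∫ x, θ x * (‖hgrad H g x‖ ^ (p - 2) *
          inner ℝ (hgrad H g x) (r • hgrad H g (dil r x) - hgrad H g x))) =
        (∫ x, w x * θ x * g (dil r x)) - ∫ x, w x * θ x * g x := by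
      rw [← integral_sub i1 i2, ← integral_add i12 i5, ← integral_sub i3 i4]
      convert hw1 using 2
      · funext x
        rw [hgrφ, inner_add_right, inner_smul_right, inner_smul_right]
        simp only [hAdef]
        ring
      · funext x
        simp only [φ]
        ring
    have e2 : r ^ (p - homDim m k) * (∫ x, E x * θ (dil r⁻¹ x)) =
        ∫ x, θ x * ‖r • hgrad H g (dil r x)‖ ^ p := by
      have h := integral_comp_dil (hE.mul (hθ.continuous.comp (continuous_dil_right r⁻¹))) hr
      simp only [Pi.mul_apply, Function.comp_apply, dil_dil, inv_mul_cancel₀ hr.ne', dil_one] at h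
      have h' : ∀ x, θ x * ‖r • hgrad H g (dil r x)‖ ^ p = r ^ p * (E (dil r x) * θ x) := fun x => by
        rw [norm_smul, Real.norm_of_nonneg hr.le, Real.mul_rpow hr.le (norm_nonneg _)]
        ring
      simp only [h', integral_const_mul]
      rw [h, Real.rpow_sub hr, homDim_eq, Real.rpow_natCast]
      ring
    have e3 : p * (∫ x, θ x * (‖hgrad H g x‖ ^ (p - 2) *
          inner ℝ (hgrad H g x) (r • hgrad H g (dil r x) - hgrad H g x))) ≤
        (∫ x, θ x * ‖r • hgrad H g (dil r x)‖ ^ p) - ∫ x, θ x * E x := by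
      rw [← integral_sub i6 i7, ← integral_const_mul]
      refine integral_mono (i5.const_mul p) (i6.sub i7) fun x => ?_
      have := mul_le_mul_of_nonneg_left
        (rpow_norm_sub_le hp (hgrad H g x) (r • hgrad H g (dil r x))) (hθ0 x)
      simp only [hEdef]
      linarith
    have e4 : ∫ x, E x * θ x = ∫ x, θ x * E x := by simp only [mul_comm]
    simp only [N, inv_one, dil_one, Real.one_rpow, one_mul, e2, e4]
    have e5 := mul_le_mul_of_nonneg_left e3 (inv_pos.mpr hp0).le
    rw [inv_mul_cancel_left₀ hp0.ne', mul_sub] at e5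
    linarith
  have := hmin.hasDerivAt_eq_zero hder
  linarith

/-! ### Cutoffs and nonnegativity of the solution -/

theorem exists_cutoff {K Ω : Set (Pt m k)} (hK : IsCompact K) (hΩ : IsOpen Ω) (hKΩ : K ⊆ Ω) :
    ∃ ψ : Pt m k → ℝ, IsTest Ω ψ ∧ (∀ᶠ x in 𝓝ˢ K, ψ x = 1) ∧ ∀ x, 0 ≤ ψ x := by
  obtain ⟨L, hL, hKL, hLΩ⟩ := exists_compact_between hK hΩ hKΩ
  obtain ⟨ψ, h1, h0, h01⟩ := exists_contMDiffMap_one_nhds_of_subset_interior (n := ⊤)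
    (modelWithCornersSelf ℝ (Pt m k)) hK.isClosed hKL
  have hs : tsupport ψ ⊆ L := closure_minimal (fun x hx => by
    by_contra h
    exact hx (h0 x h)) hL.isClosed
  exact ⟨ψ, ⟨ψ.contMDiff.contDiff, hL.of_isClosed_subset isClosed_closure hs, hs.trans hLΩ⟩, h1,
    fun x => (h01 x).1⟩

/-- The point `t` minimizes the transition function globally, which settles the endpoint `t = 0` as
well. -/
theorem deriv_smoothTransition_of_nonpos {t : ℝ} (ht : t ≤ 0) :
    deriv Real.smoothTransition t = 0 := by
  refine IsLocalMin.deriv_eq_zero (Eventually.of_forall fun s => ?_)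
  rw [Real.smoothTransition.zero_of_nonpos ht]
  exact Real.smoothTransition.nonneg s

theorem deriv_smoothTransition_of_one_le {t : ℝ} (ht : 1 ≤ t) :
    deriv Real.smoothTransition t = 0 := by
  refine IsLocalMax.deriv_eq_zero (Eventually.of_forall fun s => ?_)
  rw [Real.smoothTransition.one_of_one_le ht]
  exact Real.smoothTransition.le_one s

/-- The function `a` tends to zero at the boundary of the bounded set `Ω`. -/
def VanishesAtBoundary (Ω : Set (Pt m k)) (a : Pt m k → ℝ) : Prop :=
  ∀ ε > 0, ∃ K, IsCompact K ∧ K ⊆ Ω ∧ ∀ x ∈ Ω, x ∉ K → |a x| ≤ ε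

theorem exists_compact_of_frontier {Ω : Set (Pt m k)} (hb : Bornology.IsBounded Ω)
    {p : Pt m k → Prop} (h : ∀ x ∈ frontier Ω, ∀ᶠ y in 𝓝 x, y ∈ Ω → p y) :
    ∃ K, IsCompact K ∧ K ⊆ Ω ∧ ∀ x ∈ Ω, x ∉ K → p x := by
  refine ⟨closure Ω \ interior {y | y ∈ Ω → p y}, hb.isCompact_closure.diff isOpen_interior,
    fun x hx => ?_, fun x hx hxK => ?_⟩
  · by_contra hxΩ
    refine hx.2 (mem_interior_iff_mem_nhds.mpr (h x ⟨hx.1, fun hi => hxΩ (interior_subset hi)⟩))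
  · by_contra hp
    exact hxK ⟨subset_closure hx, fun hi => hp (interior_subset hi hx)⟩

theorem dense_fst_ne_zero (H : HeisenbergType m k) : Dense {x : Pt m k | x.1 ≠ 0} := by
  have : Nonempty (Fin m) := ⟨⟨0, horizontal_dim_pos H⟩⟩
  exact (dense_compl_singleton (0 : EuclideanSpace ℝ (Fin m))).preimage isOpenMap_fst

/-- Weak equation `Δ_{H,p} f = -|z|^p` tested with compactly supported `C¹` functions. -/
def IsWeakC1Solution (H : HeisenbergType m k) (p : ℝ) (Ω : Set (Pt m k)) (f : Pt m k → ℝ) : Prop :=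
  ∀ φ, ContDiff ℝ 1 φ → HasCompactSupport φ → tsupport φ ⊆ Ω →
    ∫ x in Ω, ‖hgrad H f x‖ ^ (p - 2) * inner ℝ (hgrad H f x) (hgrad H φ x) =
      ∫ x in Ω, ‖x.1‖ ^ p * φ x

theorem rpow_sub_two_mul_sq {p : ℝ} (hp : 1 < p) {t : ℝ} (ht : 0 ≤ t) :
    t ^ (p - 2) * t ^ 2 = t ^ p := by
  rcases ht.eq_or_lt with rfl | ht
  · rw [Real.zero_rpow (by linarith : p ≠ 0)]
    simp
  · rw [← Real.rpow_natCast t 2, ← Real.rpow_add ht]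
    congr 1
    push_cast
    ring

/-- Weak minimum principle. A nondecreasing function of `-f - ε`, supported where `f < -ε`, makes
the left side of the weak equation nonpositive. The right side would be positive if `f < -ε` at some
point with `z ≠ 0`; the points with `z = 0` follow by continuity and density. -/
theorem nonneg_of_isWeakC1Solution {H : HeisenbergType m k} {p : ℝ} (hp : 1 < p)
    {Ω : Set (Pt m k)} (hΩ : IsOpen Ω) {f : Pt m k → ℝ} (hf : ContDiffOn ℝ 1 f Ω)
    (hweak : IsWeakC1Solution H p Ω f)
    (hdecay : VanishesAtBoundary Ω f) :
    ∀ x ∈ Ω, 0 ≤ f x := by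
  have hp0 : 0 < p := by linarith
  have hdf : ∀ x ∈ Ω, DifferentiableAt ℝ f x := fun x hx =>
    (hf.differentiableOn one_ne_zero).differentiableAt (hΩ.mem_nhds hx)
  have key : ∀ ε > 0, ∀ x ∈ Ω, x.1 ≠ 0 → -ε ≤ f x := by
    intro ε hε x hx hx1
    obtain ⟨K, hK, hKΩ, hKf⟩ := hdecay ε hε
    let φ : Pt m k → ℝ := Ω.indicator fun y => Real.smoothTransition (-f y - ε)
    have h0 : ∀ y ∈ Ω, y ∉ K → Real.smoothTransition (-f y - ε) = 0 := fun y hy hyK => by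
      refine Real.smoothTransition.zero_of_nonpos ?_
      have := abs_le.mp (hKf y hy hyK)
      linarith
    have hφ : ContDiff ℝ 1 φ := by
      refine contDiff_indicator hΩ hK.isClosed hKΩ ?_ h0
      exact (Real.smoothTransition.contDiff (n := 1)).comp_contDiffOn (hf.neg.sub contDiffOn_const)
    have hφs : tsupport φ ⊆ K := tsupport_indicator_subset hK.isClosed h0
    have hφc : HasCompactSupport φ := hK.of_isClosed_subset isClosed_closure hφs
    have hφ0 : ∀ y, 0 ≤ φ y := fun y =>
      Set.indicator_nonneg (fun _ _ => Real.smoothTransition.nonneg _) y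
    have hgφ : ∀ y ∈ Ω, hgrad H φ y =
        (-deriv Real.smoothTransition (-f y - ε)) • hgrad H f y := fun y hy => by
      have e : φ =ᶠ[𝓝 y] fun y => Real.smoothTransition (-f y - ε) := by
        filter_upwards [hΩ.mem_nhds hy] with z hz
        exact Set.indicator_of_mem hz _
      have hd := (((Real.smoothTransition.contDiff (n := 1)).differentiable one_ne_zero
        (-f y - ε)).hasDerivAt).comp_hasFDerivAt y ((hdf y hy).hasFDerivAt.fun_neg.sub_const ε)
      have hd' : DifferentiableAt ℝ (fun y => Real.smoothTransition (-f y - ε)) y :=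
        hd.differentiableAt
      rw [hgrad_congr H e, hgrad_eq_horiz H hd', hgrad_eq_horiz H (hdf y hy),
        ← horiz_smul]
      congr 1
      refine hd.fderiv.trans ?_
      ext w <;> simp
    have hle : ∫ y in Ω, ‖hgrad H f y‖ ^ (p - 2) * inner ℝ (hgrad H f y) (hgrad H φ y) ≤ 0 := by
      refine setIntegral_nonpos hΩ.measurableSet fun y hy => ?_
      rw [hgφ y hy, inner_smul_right, real_inner_self_eq_norm_sq]
      have h1 : 0 ≤ deriv Real.smoothTransition (-f y - ε) :=
        Real.smoothTransition.monotone.deriv_nonneg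
      have h2 : 0 ≤ ‖hgrad H f y‖ ^ (p - 2) := by positivity
      nlinarith [mul_nonneg h2 (mul_nonneg h1 (sq_nonneg ‖hgrad H f y‖))]
    rw [hweak φ hφ hφc (hφs.trans hKΩ), setIntegral_eq_integral_of_forall_compl_eq_zero] at hle
    · have hc : Continuous fun y : Pt m k => ‖y.1‖ ^ p * φ y :=
        ((continuous_norm.comp continuous_fst).rpow_const fun _ => Or.inr hp0.le).mul hφ.continuous
      by_contra hlt
      push Not at hlt
      have hpos := hc.integral_pos_of_hasCompactSupport_nonneg_nonzero (μ := volume) (x := x)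
        hφc.mul_left (fun y => mul_nonneg (by positivity) (hφ0 y)) (by
          have h1 : 0 < ‖x.1‖ ^ p := Real.rpow_pos_of_pos (norm_pos_iff.mpr hx1) p
          have h2 : 0 < φ x := by
            simp only [φ, Set.indicator_of_mem hx]
            exact Real.smoothTransition.pos_of_pos (by linarith)
          exact (mul_pos h1 h2).ne')
      linarith
    · intro y hy
      simp [φ, Set.indicator_of_notMem hy]
  intro x hx
  by_contra hlt
  push Not at hlt
  have hopen : IsOpen (Ω ∩ f ⁻¹' Set.Iio (f x / 2)) :=
    hf.continuousOn.isOpen_inter_preimage hΩ isOpen_Iio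
  obtain ⟨y, ⟨hyΩ, hy⟩, hy1⟩ := (dense_fst_ne_zero H).inter_open_nonempty _ hopen
    ⟨x, hx, by simp only [Set.mem_preimage, Set.mem_Iio]; linarith⟩
  have := key (-(f x / 2)) (by linarith) y hyΩ hy1
  simp only [Set.mem_preimage, Set.mem_Iio] at hy
  linarith

/-! ### Level-set cutoffs and the localized Pohozaev identity -/

/-- Cutoff functions `θ` that are functions of `f` near the boundary; `fderiv θ = d • fderiv f`. -/
structure IsLevelCutoff (Ω : Set (Pt m k)) (f θ d : Pt m k → ℝ) : Prop where
  contDiff : ContDiff ℝ 1 θ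
  hasCompactSupport : HasCompactSupport θ
  tsupport_subset : tsupport θ ⊆ Ω
  nonneg : ∀ x, 0 ≤ θ x
  le_one : ∀ x, θ x ≤ 1
  fderiv_eq : ∀ x ∈ Ω, fderiv ℝ θ x = d x • fderiv ℝ f x
  d_nonneg : ∀ x ∈ Ω, 0 ≤ d x
  d_continuousOn : ContinuousOn d Ω
  d_eq_zero : ∀ x ∈ Ω, x ∉ tsupport θ → d x = 0

/-- The cutoff is `0` where `f + ψ ≤ ε` and `1` where `f + ψ ≥ 2ε`. By `hlow` it is already
saturated on `tsupport ψ`, so the gradient of `ψ` never contributes and `fderiv θ` is a multiple of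
`fderiv f`. -/
theorem isLevelCutoff_smoothTransition {Ω : Set (Pt m k)} (hΩ : IsOpen Ω) {f ψ : Pt m k → ℝ}
    (hf : ContDiffOn ℝ 1 f Ω) (hψ : ContDiff ℝ 1 ψ) (hψc : HasCompactSupport ψ)
    (hψΩ : tsupport ψ ⊆ Ω) {ε : ℝ} (hε : 0 < ε)
    (hlow : ∀ x ∈ tsupport ψ, 2 * ε ≤ f x + ψ x)
    (hdecay : ∃ K, IsCompact K ∧ K ⊆ Ω ∧ ∀ x ∈ Ω, x ∉ K → |f x| ≤ ε) :
    IsLevelCutoff Ω f (Ω.indicator fun x => Real.smoothTransition (ε⁻¹ * (f x + ψ x) - 1))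
      (fun x => ε⁻¹ * deriv Real.smoothTransition (ε⁻¹ * (f x + ψ x) - 1)) := by
  obtain ⟨K, hK, hKΩ, hKf⟩ := hdecay
  have hdf : ∀ x ∈ Ω, DifferentiableAt ℝ f x := fun x hx =>
    (hf.differentiableOn one_ne_zero).differentiableAt (hΩ.mem_nhds hx)
  have hL : IsCompact (K ∪ tsupport ψ) := hK.union hψc.isCompact
  have h0 : ∀ x ∈ Ω, x ∉ K ∪ tsupport ψ →
      Real.smoothTransition (ε⁻¹ * (f x + ψ x) - 1) = 0 := fun x hx hxL => by
    rw [Set.mem_union, not_or] at hxL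
    refine Real.smoothTransition.zero_of_nonpos ?_
    rw [image_eq_zero_of_notMem_tsupport hxL.2, add_zero, sub_nonpos, inv_mul_le_iff₀ hε, mul_one]
    exact (le_abs_self _).trans (hKf x hx hxL.1)
  have hs := tsupport_indicator_subset (Ω := Ω) hL.isClosed h0
  have hh : ContDiffOn ℝ 1 (fun x => ε⁻¹ * (f x + ψ x) - 1) Ω :=
    (contDiffOn_const.mul (hf.add hψ.contDiffOn)).sub contDiffOn_const
  exact
    { contDiff := contDiff_indicator hΩ hL.isClosed (Set.union_subset hKΩ hψΩ)
        ((Real.smoothTransition.contDiff (n := 1)).comp_contDiffOn hh) h0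
      hasCompactSupport := hL.of_isClosed_subset isClosed_closure hs
      tsupport_subset := hs.trans (Set.union_subset hKΩ hψΩ)
      nonneg := fun x => Set.indicator_nonneg (fun _ _ => Real.smoothTransition.nonneg _) x
      le_one := fun x => Set.indicator_le' (fun _ _ => Real.smoothTransition.le_one _)
        (fun _ _ => zero_le_one) x
      d_nonneg := fun x _ => mul_nonneg (inv_pos.mpr hε).le
        Real.smoothTransition.monotone.deriv_nonneg
      d_continuousOn := continuousOn_const.mul
        (((Real.smoothTransition.contDiff (n := 1)).continuous_deriv le_rfl).comp_continuousOn
          hh.continuousOn)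
      d_eq_zero := fun x hx hxs => by
        have := image_eq_zero_of_notMem_tsupport hxs
        rw [Set.indicator_of_mem hx, Real.smoothTransition.zero_iff_nonpos] at this
        rw [deriv_smoothTransition_of_nonpos this, mul_zero]
      fderiv_eq := fun x hx => by
        have e : (Ω.indicator fun x => Real.smoothTransition (ε⁻¹ * (f x + ψ x) - 1)) =ᶠ[𝓝 x]
            fun x => Real.smoothTransition (ε⁻¹ * (f x + ψ x) - 1) := by
          filter_upwards [hΩ.mem_nhds hx] with z hz
          exact Set.indicator_of_mem hz _
        have hd := (((Real.smoothTransition.contDiff (n := 1)).differentiable one_ne_zero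
          (ε⁻¹ * (f x + ψ x) - 1)).hasDerivAt).comp_hasFDerivAt x
          ((((hdf x hx).hasFDerivAt.fun_add
            (hψ.differentiable one_ne_zero x).hasFDerivAt).const_mul ε⁻¹).sub_const 1)
        rw [e.fderiv_eq]
        refine hd.fderiv.trans ?_
        by_cases hxψ : x ∈ tsupport ψ
        · have : 1 ≤ ε⁻¹ * (f x + ψ x) - 1 := by
            rw [le_sub_iff_add_le, le_inv_mul_iff₀ hε]
            linarith [hlow x hxψ]
          rw [deriv_smoothTransition_of_one_le this]
          simp
        · rw [fderiv_of_notMem_tsupport ℝ hxψ, add_zero, smul_smul, mul_comm] }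

/-- The bump `ψ` is `1` on the compact set outside which `f > 0` is known, so `f + ψ > 0` on all of
`Ω`. A zero of `f` deep inside therefore does not obstruct `θ n → 1`. -/
theorem exists_levelCutoff {Ω : Set (Pt m k)} (hΩ : IsOpen Ω) {f : Pt m k → ℝ}
    (hf : ContDiffOn ℝ 1 f Ω) (hf0 : ∀ x ∈ Ω, 0 ≤ f x)
    (hfpos : ∃ K, IsCompact K ∧ K ⊆ Ω ∧ ∀ x ∈ Ω, x ∉ K → 0 < f x)
    (hdecay : VanishesAtBoundary Ω f) :
    ∃ θ d : ℕ → Pt m k → ℝ, (∀ n, IsLevelCutoff Ω f (θ n) (d n)) ∧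
      (∀ x ∈ Ω, Tendsto (fun n => θ n x) atTop (𝓝 1)) ∧
      (∀ K, IsCompact K → K ⊆ Ω → ∀ᶠ n in atTop, ∀ x ∈ K, d n x = 0) := by
  obtain ⟨K₀, hK₀, hK₀Ω, hK₀f⟩ := hfpos
  obtain ⟨ψ, ⟨hψ, hψc, hψΩ⟩, hψ1, hψ0⟩ := exists_cutoff hK₀ hΩ hK₀Ω
  have hψ' : ContDiff ℝ 1 ψ := hψ.of_le (by simp)
  have hpos : ∀ x ∈ Ω, 0 < f x + ψ x := fun x hx => by
    by_cases hxK : x ∈ K₀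
    · have := hψ1.self_of_nhdsSet x hxK
      linarith [hf0 x hx]
    · linarith [hK₀f x hx hxK, hψ0 x]
  have hc : ContinuousOn (fun x => f x + ψ x) Ω := hf.continuousOn.add hψ.continuous.continuousOn
  have hmin : ∀ K, IsCompact K → K ⊆ Ω → ∃ δ > 0, ∀ x ∈ K, δ ≤ f x + ψ x := fun K hK hKΩ => by
    rcases K.eq_empty_or_nonempty with rfl | hne
    · exact ⟨1, one_pos, by simp⟩
    · obtain ⟨x, hx, hmin⟩ := hK.exists_isMinOn hne (hc.mono hKΩ)
      exact ⟨_, hpos x (hKΩ hx), hmin⟩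
  obtain ⟨δ, hδ, hδψ⟩ := hmin _ hψc.isCompact hψΩ
  -- The factor `δ / 2` keeps `2 * ε n` below the minimum `δ` of `f + ψ` on `tsupport ψ`, for every
  -- `n`.
  let ε : ℕ → ℝ := fun n => δ / 2 * (1 / (n + 1 : ℝ))
  have hε : ∀ n, 0 < ε n := fun n => by positivity
  have hε2 : ∀ n, 2 * ε n ≤ δ := fun n => by
    have : (1 / (n + 1 : ℝ)) ≤ 1 := by
      rw [div_le_one (by positivity)]
      linarith [(Nat.cast_nonneg n : (0 : ℝ) ≤ n)]
    simp only [ε]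
    nlinarith
  have hεlim : Tendsto ε atTop (𝓝 0) := by
    simpa [ε] using (tendsto_one_div_add_atTop_nhds_zero_nat (𝕜 := ℝ)).const_mul (δ / 2)
  have hev : ∀ δ' > 0, ∀ᶠ n in atTop, ∀ x, δ' ≤ f x + ψ x → 1 ≤ (ε n)⁻¹ * (f x + ψ x) - 1 :=
    fun δ' hδ' => by
      filter_upwards [hεlim.eventually (gt_mem_nhds (half_pos hδ'))] with n hn x hx
      rw [le_sub_iff_add_le, le_inv_mul_iff₀ (hε n)]
      linarith
  refine ⟨_, _, fun n => isLevelCutoff_smoothTransition hΩ hf hψ' hψc hψΩ (hε n)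
    (fun x hx => (hε2 n).trans (hδψ x hx)) (hdecay _ (hε n)), fun x hx => ?_, fun K hK hKΩ => ?_⟩
  · refine tendsto_const_nhds.congr' ?_
    filter_upwards [hev _ (hpos x hx)] with n hn
    rw [Set.indicator_of_mem hx, Real.smoothTransition.one_of_one_le (hn x le_rfl)]
  · obtain ⟨δ', hδ', hδK⟩ := hmin K hK hKΩ
    filter_upwards [hev δ' hδ'] with n hn x hx
    rw [deriv_smoothTransition_of_one_le (hn x (hδK x hx)), mul_zero]

theorem integral_eq_setIntegral {E : Type*} [MeasurableSpace E] {μ : Measure E} {Ω : Set E}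
    (hΩ : MeasurableSet Ω) {a b : E → ℝ} (hab : ∀ x ∈ Ω, a x = b x) (h0 : ∀ x, x ∉ Ω → a x = 0) :
    ∫ x, a x ∂μ = ∫ x in Ω, b x ∂μ := by
  rw [← setIntegral_eq_integral_of_forall_compl_eq_zero h0]
  exact setIntegral_congr_fun hΩ hab

section

variable {H : HeisenbergType m k} {p : ℝ} {Ω : Set (Pt m k)} {f θ d : Pt m k → ℝ}

theorem IsLevelCutoff.integral_norm_rpow_mul (hθ : IsLevelCutoff Ω f θ d) (hΩ : IsOpen Ω)
    (hp : 0 < p) :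
    ∫ x in Ω, ‖x.1‖ ^ p * (d x * fderiv ℝ f x (euler x)) =
      -(homDim m k + p) * ∫ x in Ω, ‖x.1‖ ^ p * θ x := by
  have h := integral_norm_rpow_mul_fderiv_euler hp hθ.contDiff hθ.hasCompactSupport
  have hout : ∀ x, x ∉ Ω → x ∉ tsupport θ := fun x hx hxs => hx (hθ.tsupport_subset hxs)
  rwa [integral_eq_setIntegral (Ω := Ω) (b := fun x => ‖x.1‖ ^ p * (d x * fderiv ℝ f x (euler x)))
      hΩ.measurableSet (fun x hx => by rw [hθ.fderiv_eq x hx]; rfl)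
      (fun x hx => by rw [fderiv_of_notMem_tsupport ℝ (hout x hx)]; simp),
    integral_eq_setIntegral (Ω := Ω) (b := fun x => ‖x.1‖ ^ p * θ x) hΩ.measurableSet
      (fun x _ => rfl)
      (fun x hx => by rw [image_eq_zero_of_notMem_tsupport (hout x hx), mul_zero])] at h

theorem continuous_norm_fst_rpow (hp : 0 ≤ p) : Continuous fun x : Pt m k => ‖x.1‖ ^ p :=
  (continuous_norm.comp continuous_fst).rpow_const fun _ => Or.inr hp

theorem IsLevelCutoff.integrableOn (hθ : IsLevelCutoff Ω f θ d) (hΩ : IsOpen Ω) {a : Pt m k → ℝ}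
    (ha : ContinuousOn a Ω) (h0 : ∀ x ∈ Ω, x ∉ tsupport θ → a x = 0) : IntegrableOn a Ω := by
  have h1 : IntegrableOn a (tsupport θ) :=
    (ha.mono hθ.tsupport_subset).integrableOn_compact hθ.hasCompactSupport.isCompact
  exact h1.of_forall_sdiff_eq_zero hΩ.measurableSet fun x hx => h0 x hx.1 hx.2

theorem continuousOn_fderiv_euler (hΩ : IsOpen Ω) (hf : ContDiffOn ℝ 1 f Ω) :
    ContinuousOn (fun x => fderiv ℝ f x (euler x)) Ω :=
  (hf.continuousOn_fderiv_of_isOpen hΩ le_rfl).clm_apply continuous_euler.continuousOn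

/-- Since `∇_H θ = d ∇_H f` and `Z θ = d Z f`, the two terms of `dilation_identity` with derivatives
of `θ` are the same integral, with coefficients `1` and `-p⁻¹`. The right side is rewritten with the
scaling law applied to `θ f`. -/
theorem IsLevelCutoff.pohozaev (hθ : IsLevelCutoff Ω f θ d) (hΩ : IsOpen Ω) (hp : 1 < p)
    (hf : ContDiffOn ℝ 1 f Ω) (hweak : IsWeakC1Solution H p Ω f) :
    (1 - p⁻¹) * (∫ x in Ω, ‖hgrad H f x‖ ^ p * (d x * fderiv ℝ f x (euler x))) +
      p⁻¹ * (p - homDim m k) * (∫ x in Ω, ‖hgrad H f x‖ ^ p * θ x) +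
      (homDim m k + p) * (∫ x in Ω, ‖x.1‖ ^ p * f x * θ x) +
      (∫ x in Ω, ‖x.1‖ ^ p * f x * (d x * fderiv ℝ f x (euler x))) = 0 := by
  have hp0 : 0 < p := by linarith
  have hdf : ∀ x ∈ Ω, DifferentiableAt ℝ f x := fun x hx =>
    (hf.differentiableOn one_ne_zero).differentiableAt (hΩ.mem_nhds hx)
  have hout : ∀ x, x ∉ Ω → x ∉ tsupport θ := fun x hx hxs => hx (hθ.tsupport_subset hxs)
  have hθz : ∀ x, x ∉ tsupport θ → θ x = 0 := fun x => image_eq_zero_of_notMem_tsupport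
  obtain ⟨ψ, ⟨hψ, hψc, hψΩ⟩, hψ1, -⟩ :=
    exists_cutoff hθ.hasCompactSupport.isCompact hΩ hθ.tsupport_subset
  have hψ' : ContDiff ℝ 1 ψ := hψ.of_le (by simp)
  -- A compactly supported global `C¹` function equal to `f` near `tsupport θ`, the only place where
  -- the identity sees it.
  let g : Pt m k → ℝ := fun x => ψ x * f x
  have hg : ContDiff ℝ 1 g := contDiff_mul_of_tsupport_subset hΩ hψ' hψΩ hf
  have hgc : HasCompactSupport g := hψc.mul_right
  have hgf : ∀ x ∈ tsupport θ, g =ᶠ[𝓝 x] f := fun x hx => by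
    filter_upwards [eventually_nhdsSet_iff_forall.mp hψ1 x hx] with y hy
    simp [g, hy]
  have hgrθ : ∀ x ∈ Ω, hgrad H θ x = d x • hgrad H f x := fun x hx => by
    rw [hgrad_eq_horiz H (hθ.contDiff.differentiable one_ne_zero x), hθ.fderiv_eq x hx,
      horiz_smul, hgrad_eq_horiz H (hdf x hx)]
  have hd0 : ∀ x ∈ Ω, x ∉ tsupport θ → d x = 0 := hθ.d_eq_zero
  have hid := dilation_identity H hp hg hgc hθ.contDiff hθ.hasCompactSupport hθ.nonneg
    (continuous_norm_fst_rpow (m := m) (k := k) hp0.le) (fun φ hφ hφs => by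
      have hφc : HasCompactSupport φ := hθ.hasCompactSupport.of_isClosed_subset isClosed_closure hφs
      have hz : ∀ x, x ∉ tsupport θ → φ x = 0 := fun x hx =>
        image_eq_zero_of_notMem_tsupport fun h => hx (hφs h)
      have hgz : ∀ x, x ∉ tsupport θ → hgrad H φ x = 0 := fun x hx =>
        hgrad_eq_zero_of_notMem_tsupport H fun h => hx (hφs h)
      have e1 : ∫ x, ‖hgrad H g x‖ ^ (p - 2) * inner ℝ (hgrad H g x) (hgrad H φ x) =
          ∫ x in Ω, ‖hgrad H f x‖ ^ (p - 2) * inner ℝ (hgrad H f x) (hgrad H φ x) := by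
        refine integral_eq_setIntegral hΩ.measurableSet (fun x _ => ?_) fun x hx => ?_
        · by_cases hxθ : x ∈ tsupport θ
          · rw [hgrad_congr H (hgf x hxθ)]
          · rw [hgz x hxθ, inner_zero_right, inner_zero_right, mul_zero, mul_zero]
        · rw [hgz x (hout x hx), inner_zero_right, mul_zero]
      have e2 : ∫ x, ‖x.1‖ ^ p * φ x = ∫ x in Ω, ‖x.1‖ ^ p * φ x :=
        integral_eq_setIntegral hΩ.measurableSet (fun x _ => rfl)
          fun x hx => by rw [hz x (hout x hx), mul_zero]
      rw [e1, e2]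
      exact hweak φ hφ hφc (hφs.trans hθ.tsupport_subset))
  have e1 : ∫ x, ‖hgrad H g x‖ ^ (p - 2) * inner ℝ (hgrad H g x) (hgrad H θ x) *
        fderiv ℝ g x (euler x) =
      ∫ x in Ω, ‖hgrad H f x‖ ^ p * (d x * fderiv ℝ f x (euler x)) := by
    refine integral_eq_setIntegral hΩ.measurableSet (fun x hx => ?_) fun x hx => ?_
    · by_cases hxθ : x ∈ tsupport θ
      · rw [hgrad_congr H (hgf x hxθ), hgrθ x hx, (hgf x hxθ).fderiv_eq, inner_smul_right,
          real_inner_self_eq_norm_sq, ← rpow_sub_two_mul_sq hp (norm_nonneg (hgrad H f x))]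
        ring
      · rw [hgrad_eq_zero_of_notMem_tsupport H hxθ, hd0 x hx hxθ]
        simp
    · rw [hgrad_eq_zero_of_notMem_tsupport H (hout x hx)]
      simp
  have e2 : ∫ x, ‖hgrad H g x‖ ^ p * θ x = ∫ x in Ω, ‖hgrad H f x‖ ^ p * θ x := by
    refine integral_eq_setIntegral hΩ.measurableSet (fun x _ => ?_) fun x hx => ?_
    · by_cases hxθ : x ∈ tsupport θ
      · rw [hgrad_congr H (hgf x hxθ)]
      · rw [hθz x hxθ, mul_zero, mul_zero]
    · rw [hθz x (hout x hx), mul_zero]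
  have e3 : ∫ x, ‖hgrad H g x‖ ^ p * fderiv ℝ θ x (euler x) =
      ∫ x in Ω, ‖hgrad H f x‖ ^ p * (d x * fderiv ℝ f x (euler x)) := by
    refine integral_eq_setIntegral hΩ.measurableSet (fun x hx => ?_) fun x hx => ?_
    · by_cases hxθ : x ∈ tsupport θ
      · rw [hgrad_congr H (hgf x hxθ), hθ.fderiv_eq x hx]
        rfl
      · rw [fderiv_of_notMem_tsupport ℝ hxθ, hd0 x hx hxθ]
        simp
    · rw [fderiv_of_notMem_tsupport ℝ (hout x hx)]
      simp
  have e4 : ∫ x, ‖x.1‖ ^ p * θ x * fderiv ℝ g x (euler x) =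
      ∫ x in Ω, ‖x.1‖ ^ p * θ x * fderiv ℝ f x (euler x) := by
    refine integral_eq_setIntegral hΩ.measurableSet (fun x _ => ?_) fun x hx => ?_
    · by_cases hxθ : x ∈ tsupport θ
      · rw [(hgf x hxθ).fderiv_eq]
      · rw [hθz x hxθ, mul_zero, zero_mul, zero_mul]
    · rw [hθz x (hout x hx), mul_zero, zero_mul]
  rw [e1, e2, e3, e4] at hid
  have hu := integral_norm_rpow_mul_fderiv_euler (m := m) (k := k) hp0
    (u := fun x => θ x * f x)
    (contDiff_mul_of_tsupport_subset hΩ hθ.contDiff hθ.tsupport_subset hf)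
    hθ.hasCompactSupport.mul_right
  have hs : ∀ x, x ∉ tsupport θ → x ∉ tsupport fun x => θ x * f x := fun x hx h =>
    hx (closure_mono (fun y hy => left_ne_zero_of_mul hy) h)
  have e5 : ∫ x, ‖x.1‖ ^ p * fderiv ℝ (fun x => θ x * f x) x (euler x) =
      ∫ x in Ω, (‖x.1‖ ^ p * θ x * fderiv ℝ f x (euler x) +
        ‖x.1‖ ^ p * f x * (d x * fderiv ℝ f x (euler x))) := by
    refine integral_eq_setIntegral hΩ.measurableSet (fun x hx => ?_) fun x hx => ?_
    · rw [fderiv_fun_mul (hθ.contDiff.differentiable one_ne_zero x) (hdf x hx),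
        hθ.fderiv_eq x hx]
      simp only [add_apply, smul_apply, smul_eq_mul]
      ring
    · rw [fderiv_of_notMem_tsupport ℝ (hs x (hout x hx))]
      simp
  have e6 : ∫ x, ‖x.1‖ ^ p * (θ x * f x) = ∫ x in Ω, ‖x.1‖ ^ p * f x * θ x :=
    integral_eq_setIntegral hΩ.measurableSet (fun x _ => by ring)
      fun x hx => by rw [hθz x (hout x hx), zero_mul, mul_zero]
  rw [e5, e6] at hu
  have hZ := continuousOn_fderiv_euler hΩ hf
  have hn := (continuous_norm_fst_rpow (m := m) (k := k) hp0.le).continuousOn (s := Ω)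
  rw [integral_add] at hu
  · linarith
  · exact hθ.integrableOn hΩ ((hn.mul hθ.contDiff.continuous.continuousOn).mul hZ) fun x _ hx => by
      rw [hθz x hx, mul_zero, zero_mul]
  · exact hθ.integrableOn hΩ ((hn.mul hf.continuousOn).mul (hθ.d_continuousOn.mul hZ))
      fun x hx hxθ => by rw [hd0 x hx hxθ, zero_mul, mul_zero]

/-! ### Uniform bound on the mass of the boundary layer -/

/-- Integrating by parts moves the derivative from `θ` to `b`; with `0 ≤ θ ≤ 1` the bound no longer
depends on `θ`. -/
theorem IsLevelCutoff.integral_mul_fderiv_frameVec_le (hθ : IsLevelCutoff Ω f θ d)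
    {b : Pt m k → ℝ} (hb : ContDiff ℝ 1 b) (hbc : HasCompactSupport b) (v : Pt m k) :
    ∫ x in Ω, b x * fderiv ℝ θ x (frameVec H v x) ≤ ∫ x, |fderiv ℝ b x (frameVec H v x)| := by
  have hbD : Continuous fun x => fderiv ℝ b x (frameVec H v x) :=
    (hb.continuous_fderiv one_ne_zero).clm_apply (contDiff_frameVec H v).continuous
  have hθD : Continuous fun x => fderiv ℝ θ x (frameVec H v x) :=
    (hθ.contDiff.continuous_fderiv one_ne_zero).clm_apply (contDiff_frameVec H v).continuous
  have hbDc : HasCompactSupport fun x => fderiv ℝ b x (frameVec H v x) :=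
    HasCompactSupport.intro hbc fun x hx => by rw [fderiv_of_notMem_tsupport ℝ hx]; simp
  have hint : Integrable fun x => b x * fderiv ℝ θ x (frameVec H v x) :=
    (hb.continuous.mul hθD).integrable_of_hasCompactSupport hbc.mul_right
  have hint' : Integrable fun x => θ x * fderiv ℝ b x (frameVec H v x) :=
    (hθ.contDiff.continuous.mul hbD).integrable_of_hasCompactSupport hbDc.mul_left
  have h0 := integral_fderiv_frameVec H (hb.mul hθ.contDiff) hbc.mul_right v
  have h1 : ∀ x, fderiv ℝ (b * θ : Pt m k → ℝ) x (frameVec H v x) =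
      b x * fderiv ℝ θ x (frameVec H v x) + θ x * fderiv ℝ b x (frameVec H v x) := fun x => by
    rw [fderiv_mul (hb.differentiable one_ne_zero x) (hθ.contDiff.differentiable one_ne_zero x)]
    rfl
  change ∫ x, fderiv ℝ (b * θ : Pt m k → ℝ) x (frameVec H v x) = 0 at h0
  simp only [h1] at h0
  rw [integral_add hint hint'] at h0
  rw [setIntegral_eq_integral_of_forall_compl_eq_zero, eq_neg_of_add_eq_zero_left h0,
    ← integral_neg]
  · refine integral_mono hint'.neg (hbD.abs.integrable_of_hasCompactSupport
      (hbDc.comp_left (g := fun t : ℝ => |t|) abs_zero)) fun x => ?_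
    refine (neg_le_abs _).trans ?_
    rw [abs_mul, abs_of_nonneg (hθ.nonneg x)]
    exact mul_le_of_le_one_left (abs_nonneg _) (hθ.le_one x)
  · intro x hx
    rw [fderiv_of_notMem_tsupport ℝ fun h => hx (hθ.tsupport_subset h)]
    simp

/-- Where `f` increases at rate at least `δ` along one fixed left-invariant field, `d |Z f|` is at
most `M / δ` times the derivative of `θ` along that field. The integral of the latter against a bump
is bounded independently of `θ`. -/
theorem exists_bound_of_forall_mem_ball (hΩ : IsOpen Ω) {x₀ v : Pt m k} {r δ M : ℝ} (hr : 0 < r)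
    (hδ : 0 < δ) (hM : 0 ≤ M) (hball : ∀ x ∈ Metric.ball x₀ r, x ∈ Ω →
      δ ≤ fderiv ℝ f x (frameVec H v x) ∧ |fderiv ℝ f x (euler x)| ≤ M) :
    ∃ C : ℝ, 0 ≤ C ∧ ∀ θ d, IsLevelCutoff Ω f θ d →
      ∫⁻ x in Ω ∩ Metric.ball x₀ (r / 2), ENNReal.ofReal (d x * |fderiv ℝ f x (euler x)|) ≤
        ENNReal.ofReal C := by
  let b : ContDiffBump x₀ := ⟨r / 2, r, by positivity, by linarith⟩
  have hb : ContDiff ℝ 1 b := b.contDiff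
  have hbc : HasCompactSupport (b : Pt m k → ℝ) := b.hasCompactSupport
  refine ⟨M / δ * ∫ x, |fderiv ℝ b x (frameVec H v x)|,
    mul_nonneg (by positivity) (integral_nonneg fun _ => abs_nonneg _), fun θ d hθ => ?_⟩
  have hθD : Continuous fun x => fderiv ℝ θ x (frameVec H v x) :=
    (hθ.contDiff.continuous_fderiv one_ne_zero).clm_apply (contDiff_frameVec H v).continuous
  have hθq : ∀ x ∈ Ω, fderiv ℝ θ x (frameVec H v x) = d x * fderiv ℝ f x (frameVec H v x) :=
    fun x hx => by
      rw [hθ.fderiv_eq x hx]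
      rfl
  have hpos : ∀ x ∈ Ω, 0 ≤ b x * fderiv ℝ θ x (frameVec H v x) := fun x hx => by
    by_cases hxb : x ∈ Metric.ball x₀ r
    · rw [hθq x hx]
      exact mul_nonneg b.nonneg (mul_nonneg (hθ.d_nonneg x hx) (hδ.le.trans (hball x hxb hx).1))
    · rw [b.zero_of_le_dist (not_lt.mp hxb), zero_mul]
  have hint : Integrable fun x => b x * fderiv ℝ θ x (frameVec H v x) :=
    (hb.continuous.mul hθD).integrable_of_hasCompactSupport hbc.mul_right
  calc ∫⁻ x in Ω ∩ Metric.ball x₀ (r / 2), ENNReal.ofReal (d x * |fderiv ℝ f x (euler x)|)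
      ≤ ∫⁻ x in Ω ∩ Metric.ball x₀ (r / 2),
          ENNReal.ofReal (M / δ * (b x * fderiv ℝ θ x (frameVec H v x))) := by
        refine setLIntegral_mono' (hΩ.inter Metric.isOpen_ball).measurableSet fun x hx => ?_
        refine ENNReal.ofReal_le_ofReal ?_
        have hd := hθ.d_nonneg x hx.1
        have hbx : b x = 1 := b.one_of_mem_closedBall (Metric.ball_subset_closedBall hx.2)
        obtain ⟨h1, h2⟩ := hball x (Metric.ball_subset_ball (by linarith) hx.2) hx.1
        rw [hbx, one_mul, hθq x hx.1]
        calc d x * |fderiv ℝ f x (euler x)| ≤ d x * M := by gcongr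
          _ = M / δ * (d x * δ) := by field_simp
          _ ≤ M / δ * (d x * fderiv ℝ f x (frameVec H v x)) := by gcongr
    _ ≤ ∫⁻ x in Ω, ENNReal.ofReal (M / δ * (b x * fderiv ℝ θ x (frameVec H v x))) :=
        lintegral_mono_set Set.inter_subset_left
    _ = ENNReal.ofReal (∫ x in Ω, M / δ * (b x * fderiv ℝ θ x (frameVec H v x))) := by
        rw [ofReal_integral_eq_lintegral_ofReal (hint.const_mul _).integrableOn]
        exact (ae_restrict_mem hΩ.measurableSet).mono fun x hx =>
          mul_nonneg (by positivity) (hpos x hx)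
    _ ≤ ENNReal.ofReal (M / δ * ∫ x, |fderiv ℝ b x (frameVec H v x)|) := by
        rw [integral_const_mul]
        gcongr
        exact hθ.integral_mul_fderiv_frameVec_le hb hbc v

/-- The inner product of the frame coordinates. -/
def framePairing (v r : Pt m k) : ℝ := inner ℝ r.1 v.1 + inner ℝ r.2 v.2

theorem framePairing_self_pos {g : Pt m k} (hg : g ≠ 0) : 0 < framePairing g g := by
  simp only [framePairing, real_inner_self_eq_norm_sq]
  rcases eq_or_ne g.1 0 with h | h
  · have h2 : g.2 ≠ 0 := fun h2 => hg (Prod.ext h h2)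
    have := norm_pos_iff.mpr h2
    positivity
  · have := norm_pos_iff.mpr h
    positivity

theorem frameVec_euler (H : HeisenbergType m k) (x : Pt m k) :
    frameVec H (euler x) x = euler x := by
  ext1 <;> simp [frameVec, euler, H.bracket_self]

theorem tendsto_framePairing {r : Pt m k → Pt m k} {v : Pt m k → Pt m k} {x₀ g : Pt m k}
    {l : Filter (Pt m k)} (hv : Tendsto v l (𝓝 x₀)) (hr : Tendsto r l (𝓝 g)) :
    Tendsto (fun x => framePairing (v x) (r x)) l (𝓝 (framePairing x₀ g)) :=
  (hr.fst_nhds.inner hv.fst_nhds).add (hr.snd_nhds.inner hv.snd_nhds)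

theorem exists_ball_forall_framePairing {r : Pt m k → Pt m k} {x₀ g : Pt m k}
    (hg : g ≠ 0) (hlim : Tendsto r (𝓝[Ω] x₀) (𝓝 g)) :
    ∃ ρ > 0, ∀ x ∈ Metric.ball x₀ ρ, x ∈ Ω → framePairing g g / 2 < framePairing g (r x) ∧
      |framePairing (euler x) (r x)| < |framePairing (euler x₀) g| + 1 := by
  have l1 := tendsto_framePairing (tendsto_const_nhds (x := g)) hlim
  have l2 := (tendsto_framePairing
    ((continuous_euler.tendsto x₀).mono_left (nhdsWithin_le_nhds (s := Ω))) hlim).abs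
  have hev := (l1.eventually (lt_mem_nhds (half_lt_self (framePairing_self_pos hg)))).and
    (l2.eventually (gt_mem_nhds (lt_add_one _)))
  exact Metric.eventually_nhds_iff_ball.mp (eventually_nhdsWithin_iff.mp hev)

/-- The fixed direction is the boundary limit `g` of the gradient itself: near `x₀` the derivative
of `f` along it exceeds `|g|²/2` (Euclidean norm). -/
theorem exists_local_bound (hΩ : IsOpen Ω) (hf : ContDiffOn ℝ 1 f Ω) {x₀ g : Pt m k}
    (hg : g ≠ 0) (hlim : Tendsto (rgrad H f) (𝓝[Ω] x₀) (𝓝 g)) :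
    ∃ U, IsOpen U ∧ x₀ ∈ U ∧ ∃ C : ℝ, 0 ≤ C ∧ ∀ θ d, IsLevelCutoff Ω f θ d →
      ∫⁻ x in Ω ∩ U, ENNReal.ofReal (d x * |fderiv ℝ f x (euler x)|) ≤ ENNReal.ofReal C := by
  have hdf : ∀ x ∈ Ω, DifferentiableAt ℝ f x := fun x hx =>
    (hf.differentiableOn one_ne_zero).differentiableAt (hΩ.mem_nhds hx)
  have hq : ∀ x ∈ Ω, ∀ v, fderiv ℝ f x (frameVec H v x) = framePairing v (rgrad H f x) :=
    fun x hx v => fderiv_frameVec_eq_inner H (hdf x hx) v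
  obtain ⟨r, hr, hball⟩ := exists_ball_forall_framePairing hg hlim
  have hb : ∀ x ∈ Metric.ball x₀ r, x ∈ Ω →
      framePairing g g / 2 ≤ fderiv ℝ f x (frameVec H g x) ∧
        |fderiv ℝ f x (euler x)| ≤ |framePairing (euler x₀) g| + 1 := fun x hx hxΩ => by
    obtain ⟨h1, h2⟩ := hball x hx hxΩ
    rw [← hq x hxΩ, frameVec_euler] at h2
    rw [← hq x hxΩ] at h1
    exact ⟨h1.le, h2.le⟩
  have h := exists_bound_of_forall_mem_ball hΩ hr (half_pos (framePairing_self_pos hg))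
    (by positivity) hb
  exact ⟨Metric.ball x₀ (r / 2), Metric.isOpen_ball, Metric.mem_ball_self (half_pos hr), h⟩

theorem exists_uniform_bound (hΩ : IsOpen Ω) (hb : Bornology.IsBounded Ω)
    (hf : ContDiffOn ℝ 1 f Ω) (hgrad : RGradNonvanishingOnBoundary H Ω f) :
    ∃ K, IsCompact K ∧ K ⊆ Ω ∧ ∃ C : ℝ, 0 ≤ C ∧ ∀ θ d, IsLevelCutoff Ω f θ d →
      (∀ x ∈ K, d x = 0) → ∫ x in Ω, d x * |fderiv ℝ f x (euler x)| ≤ C := by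
  have hfr : IsCompact (frontier Ω) :=
    hb.isCompact_closure.of_isClosed_subset isClosed_frontier frontier_subset_closure
  obtain ⟨U, hU, hUΩ, C, hC, hbound⟩ := hfr.induction_on
    (p := fun S => ∃ U, IsOpen U ∧ S ⊆ U ∧ ∃ C : ℝ, 0 ≤ C ∧ ∀ θ d, IsLevelCutoff Ω f θ d →
      ∫⁻ x in Ω ∩ U, ENNReal.ofReal (d x * |fderiv ℝ f x (euler x)|) ≤ ENNReal.ofReal C)
    ⟨∅, isOpen_empty, subset_rfl, 0, le_rfl, fun θ d _ => by simp⟩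
    (fun S T hST ⟨U, hU, hTU, h⟩ => ⟨U, hU, hST.trans hTU, h⟩)
    (fun S T ⟨U, hU, hSU, C, hC, h⟩ ⟨V, hV, hTV, C', hC', h'⟩ =>
      ⟨U ∪ V, hU.union hV, Set.union_subset_union hSU hTV, C + C', by positivity, fun θ d hθ => by
        rw [Set.inter_union_distrib_left, ENNReal.ofReal_add hC hC']
        exact (lintegral_union_le _ _ _).trans (add_le_add (h θ d hθ) (h' θ d hθ))⟩)
    (fun x hx => by
      obtain ⟨g, hg, hlim⟩ := hgrad x hx
      obtain ⟨U, hU, hxU, h⟩ := exists_local_bound hΩ hf hg hlim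
      exact ⟨U, mem_nhdsWithin_of_mem_nhds (hU.mem_nhds hxU), U, hU, subset_rfl, h⟩)
  have hKΩ : closure Ω \ U ⊆ Ω := fun x hx => by
    by_contra hxΩ
    exact hx.2 (hUΩ ⟨hx.1, fun h => hxΩ (interior_subset h)⟩)
  refine ⟨closure Ω \ U, hb.isCompact_closure.diff hU, hKΩ, C, hC, fun θ d hθ hd => ?_⟩
  have h0 : ∀ x ∈ Ω, 0 ≤ d x * |fderiv ℝ f x (euler x)| := fun x hx =>
    mul_nonneg (hθ.d_nonneg x hx) (abs_nonneg _)
  have hi : IntegrableOn (fun x => d x * |fderiv ℝ f x (euler x)|) Ω :=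
    hθ.integrableOn hΩ (hθ.d_continuousOn.mul (continuousOn_fderiv_euler hΩ hf).abs)
      fun x hx hxθ => by rw [hθ.d_eq_zero x hx hxθ, zero_mul]
  have h1 : ∫ x in Ω, d x * |fderiv ℝ f x (euler x)| =
      ∫ x in Ω ∩ U, d x * |fderiv ℝ f x (euler x)| := by
    refine setIntegral_eq_of_subset_of_forall_sdiff_eq_zero hΩ.measurableSet
      Set.inter_subset_left fun x hx => ?_
    rw [hd x ⟨subset_closure hx.1, fun h => hx.2 ⟨hx.1, h⟩⟩, zero_mul]
  rw [h1, integral_eq_lintegral_of_nonneg_ae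
    ((ae_restrict_mem (hΩ.inter hU).measurableSet).mono fun x hx => h0 x hx.1)
    (hi.mono_set Set.inter_subset_left).1]
  exact ENNReal.toReal_le_of_le_ofReal hC (hbound θ d hθ)

end

/-! ### Passage to the limit in the Pohozaev identity -/

section

variable {H : HeisenbergType m k} {p : ℝ} {Ω : Set (Pt m k)} {f : Pt m k → ℝ}

theorem VanishesAtBoundary.mul_bounded {a b : Pt m k → ℝ} (ha : VanishesAtBoundary Ω a) {M : ℝ}
    (hM : ∀ x ∈ Ω, |b x| ≤ M) : VanishesAtBoundary Ω fun x => b x * a x := fun ε hε => by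
  obtain ⟨K, hK, hKΩ, h⟩ := ha (ε / (|M| + 1)) (by positivity)
  refine ⟨K, hK, hKΩ, fun x hx hxK => ?_⟩
  have hM1 : |b x| ≤ |M| + 1 := by linarith [hM x hx, le_abs_self M]
  rw [abs_mul]
  calc |b x| * |a x| ≤ (|M| + 1) * (ε / (|M| + 1)) :=
        mul_le_mul hM1 (h x hx hxK) (abs_nonneg _) (by positivity)
    _ = ε := by field_simp

theorem integrableOn_of_continuousOn_of_bounded (hΩ : IsOpen Ω) (hb : Bornology.IsBounded Ω)
    {a : Pt m k → ℝ} (ha : ContinuousOn a Ω) {M : ℝ} (hM : ∀ x ∈ Ω, |a x| ≤ M) :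
    IntegrableOn a Ω :=
  IntegrableOn.of_bound hb.measure_lt_top (ha.aestronglyMeasurable hΩ.measurableSet) M
    ((ae_restrict_mem hΩ.measurableSet).mono hM)

theorem tendsto_integral_mul_levelCutoff (hΩ : IsOpen Ω) (hb : Bornology.IsBounded Ω)
    {a : Pt m k → ℝ} (ha : ContinuousOn a Ω) {M : ℝ} (hM : ∀ x ∈ Ω, |a x| ≤ M)
    {θ d : ℕ → Pt m k → ℝ} (hθ : ∀ n, IsLevelCutoff Ω f (θ n) (d n))
    (hθ1 : ∀ x ∈ Ω, Tendsto (fun n => θ n x) atTop (𝓝 1)) :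
    Tendsto (fun n => ∫ x in Ω, a x * θ n x) atTop (𝓝 (∫ x in Ω, a x)) := by
  refine tendsto_integral_of_dominated_convergence (fun x => |a x|) (fun n => ?_)
    (integrableOn_of_continuousOn_of_bounded hΩ hb ha hM).abs
    (fun n => Eventually.of_forall fun x => ?_)
    ((ae_restrict_mem hΩ.measurableSet).mono fun x hx => ?_)
  · exact (ha.mul (hθ n).contDiff.continuous.continuousOn).aestronglyMeasurable hΩ.measurableSet
  · rw [Real.norm_eq_abs, abs_mul, abs_of_nonneg ((hθ n).nonneg x)]
    exact mul_le_of_le_one_right (abs_nonneg _) ((hθ n).le_one x)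
  · simpa using (hθ1 x hx).const_mul (a x)

/-- The measures `d n |Z f| dx` eventually leave every compact subset of `Ω` and have bounded mass,
so against them a function vanishing at the boundary integrates to `o(1)`. -/
theorem tendsto_integral_mul_fderiv_euler_zero (hΩ : IsOpen Ω) (hb : Bornology.IsBounded Ω)
    (hf : ContDiffOn ℝ 1 f Ω) (hgrad : RGradNonvanishingOnBoundary H Ω f)
    {a : Pt m k → ℝ} (ha0 : VanishesAtBoundary Ω a)
    {θ d : ℕ → Pt m k → ℝ} (hθ : ∀ n, IsLevelCutoff Ω f (θ n) (d n))
    (hd : ∀ K, IsCompact K → K ⊆ Ω → ∀ᶠ n in atTop, ∀ x ∈ K, d n x = 0) :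
    Tendsto (fun n => ∫ x in Ω, a x * (d n x * fderiv ℝ f x (euler x))) atTop (𝓝 0) := by
  obtain ⟨K, hK, hKΩ, C, hC, hbound⟩ := exists_uniform_bound hΩ hb hf hgrad
  rw [Metric.tendsto_atTop']
  refine fun ε hε => ?_
  obtain ⟨K', hK', hKΩ', ha'⟩ := ha0 (ε / (2 * (C + 1))) (by positivity)
  obtain ⟨N, hN⟩ := eventually_atTop.mp ((hd K hK hKΩ).and (hd K' hK' hKΩ'))
  refine ⟨N, fun n hn => ?_⟩
  obtain ⟨h1, h2⟩ := hN n hn.le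
  have hi : IntegrableOn (fun x => d n x * |fderiv ℝ f x (euler x)|) Ω :=
    (hθ n).integrableOn hΩ ((hθ n).d_continuousOn.mul (continuousOn_fderiv_euler hΩ hf).abs)
      fun x hx hxθ => by rw [(hθ n).d_eq_zero x hx hxθ, zero_mul]
  rw [dist_zero_right]
  calc ‖∫ x in Ω, a x * (d n x * fderiv ℝ f x (euler x))‖
      ≤ ∫ x in Ω, ε / (2 * (C + 1)) * (d n x * |fderiv ℝ f x (euler x)|) := by
        refine norm_integral_le_of_norm_le (hi.const_mul _)
          ((ae_restrict_mem hΩ.measurableSet).mono fun x hx => ?_)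
        rw [Real.norm_eq_abs, abs_mul, abs_mul, abs_of_nonneg ((hθ n).d_nonneg x hx)]
        by_cases hxK : x ∈ K'
        · rw [h2 x hxK]
          simp
        · exact mul_le_mul_of_nonneg_right (ha' x hx hxK)
            (mul_nonneg ((hθ n).d_nonneg x hx) (abs_nonneg _))
    _ ≤ ε / (2 * (C + 1)) * (C + 1) := by
        rw [integral_const_mul]
        gcongr
        exact (hbound _ _ (hθ n) h1).trans (by linarith)
    _ = ε / 2 := by field_simp
    _ < ε := half_lt_self hε

theorem vanishesAtBoundary_rpow_sub {u v : Pt m k → ℝ} (hp : 0 ≤ p) {M : ℝ}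
    (hu : ∀ x ∈ Ω, u x ∈ Set.Icc 0 M) (hv : ∀ x ∈ Ω, v x ∈ Set.Icc 0 M)
    (h : VanishesAtBoundary Ω fun x => u x - v x) :
    VanishesAtBoundary Ω fun x => u x ^ p - v x ^ p := fun ε hε => by
  have hc : UniformContinuousOn (fun t : ℝ => t ^ p) (Set.Icc 0 M) :=
    isCompact_Icc.uniformContinuousOn_of_continuous
      (continuous_id.rpow_const fun _ => Or.inr hp).continuousOn
  obtain ⟨δ, hδ, hδ'⟩ := Metric.uniformContinuousOn_iff.mp hc ε hε
  obtain ⟨K, hK, hKΩ, hK'⟩ := h (δ / 2) (half_pos hδ)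
  exact ⟨K, hK, hKΩ, fun x hx hxK =>
    (hδ' _ (hu x hx) _ (hv x hx) ((hK' x hx hxK).trans_lt (half_lt_self hδ))).le⟩

theorem exists_norm_fst_le (hb : Bornology.IsBounded Ω) : ∃ R : ℝ, ∀ x ∈ Ω, ‖x.1‖ ≤ R := by
  obtain ⟨R, hR⟩ := hb.exists_norm_le
  exact ⟨R, fun x hx => (norm_fst_le x).trans (hR x hx)⟩

theorem integral_P_eq (hΩ : IsOpen Ω) (hb : Bornology.IsBounded Ω) (hp : 1 < p)
    (hf : ContDiffOn ℝ 1 f Ω) (hweak : IsWeakC1Solution H p Ω f)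
    (henergy : ∫ x in Ω, ‖hgrad H f x‖ ^ p = ∫ x in Ω, ‖x.1‖ ^ p * f x)
    (hgrad' : RGradNonvanishingOnBoundary H Ω f) {M : ℝ} (hfM : ∀ x ∈ Ω, |f x| ≤ M)
    (hgM : ∀ x ∈ Ω, ‖hgrad H f x‖ ≤ M) (hf0 : ∀ x ∈ Ω, 0 ≤ f x)
    (hfpos : ∃ K, IsCompact K ∧ K ⊆ Ω ∧ ∀ x ∈ Ω, x ∉ K → 0 < f x)
    (hdecay : VanishesAtBoundary Ω f) {c : ℝ} (hc : 0 ≤ c)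
    (hgdecay : VanishesAtBoundary Ω fun x => ‖hgrad H f x‖ - c * ‖x.1‖) :
    IntegrableOn (P H p f) Ω ∧
      (∫ x in Ω, P H p f x =
        (1 + 2 * p / ((p - 1) * (homDim m k + p))) * ∫ x in Ω, ‖hgrad H f x‖ ^ p) ∧
      ∫ x in Ω, P H p f x = c ^ p * ∫ x in Ω, ‖x.1‖ ^ p := by
  have hp0 : 0 < p := by linarith
  have hQ : 0 ≤ homDim m k := by rw [homDim_eq]; positivity
  obtain ⟨R, hR⟩ := exists_norm_fst_le hb
  have hcz := (continuous_norm_fst_rpow (m := m) (k := k) hp0.le).continuousOn (s := Ω)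
  have hcg : ContinuousOn (fun x => ‖hgrad H f x‖ ^ p) Ω :=
    (continuousOn_hgrad H hΩ hf).norm.rpow_const fun _ _ => Or.inr hp0.le
  have hcf : ContinuousOn (fun x => ‖x.1‖ ^ p * f x) Ω := hcz.mul hf.continuousOn
  have hbz : ∀ x ∈ Ω, |‖x.1‖ ^ p| ≤ R ^ p := fun x hx => by
    rw [abs_of_nonneg (by positivity)]
    exact Real.rpow_le_rpow (norm_nonneg _) (hR x hx) hp0.le
  have hbg : ∀ x ∈ Ω, |‖hgrad H f x‖ ^ p| ≤ M ^ p := fun x hx => by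
    rw [abs_of_nonneg (by positivity)]
    exact Real.rpow_le_rpow (norm_nonneg _) (hgM x hx) hp0.le
  have hbf : ∀ x ∈ Ω, |‖x.1‖ ^ p * f x| ≤ R ^ p * M := fun x hx => by
    rw [abs_mul]
    exact mul_le_mul (hbz x hx) (hfM x hx) (abs_nonneg _) ((abs_nonneg _).trans (hbz x hx))
  have hig := integrableOn_of_continuousOn_of_bounded hΩ hb hcg hbg
  have hif := integrableOn_of_continuousOn_of_bounded hΩ hb hcf hbf
  have hPeq : P H p f = fun x => ‖hgrad H f x‖ ^ p +
      2 * p / ((p - 1) * (homDim m k + p)) * (‖x.1‖ ^ p * f x) := by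
    funext x
    rw [P, mul_comm (f x)]
  have hPint : ∫ x in Ω, P H p f x =
      (1 + 2 * p / ((p - 1) * (homDim m k + p))) * ∫ x in Ω, ‖hgrad H f x‖ ^ p := by
    rw [hPeq, integral_add hig (hif.const_mul _), integral_const_mul, ← henergy]
    ring
  refine ⟨hPeq ▸ hig.add (hif.const_mul _), hPint, ?_⟩
  obtain ⟨θ, d, hθ, hθ1, hd⟩ := exists_levelCutoff hΩ hf hf0 hfpos hdecay
  have hpow : VanishesAtBoundary Ω fun x => ‖hgrad H f x‖ ^ p - (c * ‖x.1‖) ^ p :=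
    vanishesAtBoundary_rpow_sub hp0.le (M := max M (c * R))
      (fun x hx => ⟨norm_nonneg _, (hgM x hx).trans (le_max_left _ _)⟩)
      (fun x hx => ⟨by positivity,
        (mul_le_mul_of_nonneg_left (hR x hx) hc).trans (le_max_right _ _)⟩) hgdecay
  have t1 := tendsto_integral_mul_fderiv_euler_zero hΩ hb hf hgrad' hpow hθ hd
  have t2 := tendsto_integral_mul_fderiv_euler_zero hΩ hb hf hgrad' (hdecay.mul_bounded hbz) hθ hd
  have t3 := tendsto_integral_mul_levelCutoff hΩ hb hcg hbg hθ hθ1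
  have t4 := tendsto_integral_mul_levelCutoff hΩ hb hcf hbf hθ hθ1
  have t5 := tendsto_integral_mul_levelCutoff hΩ hb hcz hbz hθ hθ1
  -- In the boundary term, `|∇_H f|^p` is split as `(c |z|)^p` plus a function vanishing at the
  -- boundary; the `(c |z|)^p` part is computed exactly by the scaling law for `θ n`.
  have key : ∀ n, (1 - p⁻¹) *
        ((∫ x in Ω, (‖hgrad H f x‖ ^ p - (c * ‖x.1‖) ^ p) * (d n x * fderiv ℝ f x (euler x))) +
          c ^ p * (-(homDim m k + p) * ∫ x in Ω, ‖x.1‖ ^ p * θ n x)) +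
      p⁻¹ * (p - homDim m k) * (∫ x in Ω, ‖hgrad H f x‖ ^ p * θ n x) +
      (homDim m k + p) * (∫ x in Ω, ‖x.1‖ ^ p * f x * θ n x) +
      (∫ x in Ω, ‖x.1‖ ^ p * f x * (d n x * fderiv ℝ f x (euler x))) = 0 := fun n => by
    rw [← (hθ n).integral_norm_rpow_mul hΩ hp0, ← integral_const_mul, ← integral_add,
      ← (hθ n).pohozaev hΩ hp hf hweak]
    · congr 5
      funext x
      rw [Real.mul_rpow hc (norm_nonneg _)]
      ring
    · refine (hθ n).integrableOn hΩ ((hcg.sub ?_).mul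
        ((hθ n).d_continuousOn.mul (continuousOn_fderiv_euler hΩ hf))) fun x hx hxθ => by
          rw [(hθ n).d_eq_zero x hx hxθ, zero_mul, mul_zero]
      exact ((continuous_const.mul (continuous_norm.comp continuous_fst)).rpow_const
        fun _ => Or.inr hp0.le).continuousOn
    · refine ((hθ n).integrableOn hΩ (hcz.mul
        ((hθ n).d_continuousOn.mul (continuousOn_fderiv_euler hΩ hf))) fun x hx hxθ => ?_).const_mul _
      rw [Pi.mul_apply, Pi.mul_apply, (hθ n).d_eq_zero x hx hxθ, zero_mul, mul_zero]
  have hlim := ((((t1.add ((t5.const_mul (-(homDim m k + p))).const_mul (c ^ p))).const_mul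
    (1 - p⁻¹)).add (t3.const_mul (p⁻¹ * (p - homDim m k)))).add
    (t4.const_mul (homDim m k + p))).add t2
  have h0 := tendsto_nhds_unique hlim (tendsto_const_nhds.congr fun n => (key n).symm)
  -- With `E = ∫ |z|^p f`, the limit says `(p-1)(Q+p) c^p ∫ |z|^p = ((p-1)(Q+p) + 2p) E`, which is
  -- where the constant in `P` comes from.
  rw [← henergy] at h0
  rw [hPint]
  have hp1 : p - 1 ≠ 0 := by linarith
  have hQp : homDim m k + p ≠ 0 := by positivity
  field_simp at h0 ⊢
  linarith

end

/-! ### Consequences of the boundary conditions and of the weak equation -/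

section

variable {H : HeisenbergType m k} {p : ℝ} {Ω : Set (Pt m k)} {f : Pt m k → ℝ}

/-- For continuous `u` the set where the bound fails strictly is open, so it is empty once it is
null. -/
theorem vanishesAtBoundary_of_ae (hΩ : IsOpen Ω) (hb : Bornology.IsBounded Ω) {u : Pt m k → ℝ}
    (hu : ContinuousOn u Ω) (h : ∀ ε > 0, ∃ O : Set (Pt m k), IsOpen O ∧ frontier Ω ⊆ O ∧
      ∀ᵐ x ∂(volume : Measure (Pt m k)), x ∈ Ω ∩ O → |u x| < ε) : VanishesAtBoundary Ω u := by
  intro ε hε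
  obtain ⟨O, hO, hΩO, hlt⟩ := h ε hε
  refine ⟨closure Ω \ O, hb.isCompact_closure.diff hO, fun x hx => ?_, fun x hx hxK => ?_⟩
  · by_contra hxΩ
    exact hx.2 (hΩO ⟨hx.1, fun h => hxΩ (interior_subset h)⟩)
  · have hxO : x ∈ O := by
      by_contra hxO
      exact hxK ⟨subset_closure hx, hxO⟩
    by_contra! hlt'
    have hV : IsOpen (Ω ∩ O ∩ (fun y => |u y|) ⁻¹' Set.Ioi ε) :=
      (hu.abs.mono Set.inter_subset_left).isOpen_inter_preimage (hΩ.inter hO) isOpen_Ioi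
    refine (hV.measure_pos volume ⟨x, ⟨hx, hxO⟩, hlt'⟩).ne'
      (measure_mono_null (fun y hy => ?_) (ae_iff.mp hlt))
    exact fun hy' => lt_asymm hy.2 (hy' hy.1)

theorem IsWeakSolution.isWeakC1Solution (hw : IsWeakSolution H p Ω f) (hp : 1 < p)
    (hΩ : IsOpen Ω) (hb : Bornology.IsBounded Ω) (hf : ContDiffOn ℝ 1 f Ω) :
    IsWeakC1Solution H p Ω f := by
  obtain ⟨F, hF, hweak⟩ := hw
  intro φ hφ hc hs
  rw [← hweak φ _ (memW0_of_contDiff H p hΩ hb hφ hc hs)]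
  refine integral_congr_ae ?_
  filter_upwards [hF.ae_eq_hgrad hp hΩ hb hf] with x hx
  rw [hx]

/-- The solution is an admissible test function in its own equation. -/
theorem IsWeakSolution.integral_norm_hgrad_rpow (hw : IsWeakSolution H p Ω f) (hp : 1 < p)
    (hΩ : IsOpen Ω) (hb : Bornology.IsBounded Ω) (hf : ContDiffOn ℝ 1 f Ω) :
    ∫ x in Ω, ‖hgrad H f x‖ ^ p = ∫ x in Ω, ‖x.1‖ ^ p * f x := by
  obtain ⟨F, hF, hweak⟩ := hw
  rw [← hweak f F hF]
  refine integral_congr_ae ?_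
  filter_upwards [hF.ae_eq_hgrad hp hΩ hb hf] with x hx
  rw [hx, real_inner_self_eq_norm_sq, rpow_sub_two_mul_sq hp (norm_nonneg _)]

theorem rgrad_eq_zero_of_fderiv_eq_zero {x : Pt m k} (hf : DifferentiableAt ℝ f x)
    (h : fderiv ℝ f x = 0) : rgrad H f x = 0 := by
  by_contra hr
  have h1 := fderiv_frameVec_eq_inner H hf (rgrad H f x)
  rw [h] at h1
  exact (framePairing_self_pos hr).ne h1

/-- A zero of the nonnegative function `f` in `Ω` is a minimum, so the full gradient vanishes there.
This is impossible near the boundary, where `rgrad H f` is close to a nonzero limit. -/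
theorem exists_compact_pos (hΩ : IsOpen Ω) (hb : Bornology.IsBounded Ω) (hf : ContDiffOn ℝ 1 f Ω)
    (hf0 : ∀ x ∈ Ω, 0 ≤ f x) (hgrad : RGradNonvanishingOnBoundary H Ω f) :
    ∃ K, IsCompact K ∧ K ⊆ Ω ∧ ∀ x ∈ Ω, x ∉ K → 0 < f x := by
  refine exists_compact_of_frontier hb fun x hx => ?_
  obtain ⟨g, hg, hlim⟩ := hgrad x hx
  refine (eventually_nhdsWithin_iff.mp (hlim.eventually_ne hg)).mono fun y hy hyΩ => ?_
  refine (hf0 y hyΩ).lt_of_ne fun h0 => hy hyΩ (rgrad_eq_zero_of_fderiv_eq_zero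
    ((hf.differentiableOn one_ne_zero).differentiableAt (hΩ.mem_nhds hyΩ))
    (IsLocalMin.fderiv_eq_zero ?_))
  filter_upwards [hΩ.mem_nhds hyΩ] with z hz
  exact h0 ▸ hf0 z hz

/-- If `∇_H f` vanished a.e., the equation tested with a bump around a point with `z ≠ 0` would
equate zero with a positive integral. -/
theorem IsWeakC1Solution.integral_norm_hgrad_rpow_ne_zero (hweak : IsWeakC1Solution H p Ω f)
    (hp : 1 < p) (hΩ : IsOpen Ω) (hne : Ω.Nonempty)
    (hi : IntegrableOn (fun x => ‖hgrad H f x‖ ^ p) Ω) :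
    ∫ x in Ω, ‖hgrad H f x‖ ^ p ≠ 0 := by
  intro h0
  have hae : ∀ᵐ x ∂volume.restrict Ω, hgrad H f x = 0 := by
    filter_upwards [(integral_eq_zero_iff_of_nonneg (fun x => by positivity) hi).mp h0] with x hx
    exact norm_eq_zero.mp ((Real.rpow_eq_zero (norm_nonneg _) (by linarith)).mp hx)
  obtain ⟨x₀, hx₀, hx₀1⟩ := (dense_fst_ne_zero H).inter_open_nonempty Ω hΩ hne
  obtain ⟨ψ, ⟨hψ, hψc, hψΩ⟩, hψ1, hψ0⟩ :=
    exists_cutoff (isCompact_singleton (x := x₀)) hΩ (Set.singleton_subset_iff.mpr hx₀)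
  have h1 := hweak ψ (hψ.of_le (by simp)) hψc hψΩ
  rw [integral_eq_zero_of_ae (hae.mono fun x hx => by simp [hx]),
    setIntegral_eq_integral_of_forall_compl_eq_zero] at h1
  · refine h1.not_lt (Continuous.integral_pos_of_hasCompactSupport_nonneg_nonzero (x := x₀)
      ((continuous_norm_fst_rpow (by linarith)).mul hψ.continuous) hψc.mul_left
      (fun x => mul_nonneg (by positivity) (hψ0 x)) (mul_ne_zero ?_ ?_))
    · exact (Real.rpow_pos_of_pos (norm_pos_iff.mpr hx₀1) _).ne'
    · rw [(hψ1.self_of_nhdsSet : ∀ x ∈ ({x₀} : Set _), _) x₀ rfl]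
      simp
  · intro x hx
    rw [image_eq_zero_of_notMem_tsupport fun h => hx (hψΩ h), mul_zero]

theorem IsGamma2.exists_bound {α : ℝ} (h : IsGamma2 H α Ω f) :
    ∃ M : ℝ, (∀ x ∈ Ω, |f x| ≤ M) ∧ ∀ x ∈ Ω, ‖hgrad H f x‖ ≤ M := by
  obtain ⟨M₀, hM₀, -⟩ := h.holder_zero
  choose M hM _ using h.holder_one
  refine ⟨max M₀ √(∑ i, M i ^ 2), fun x hx => (hM₀ x hx).trans (le_max_left _ _),
    fun x hx => le_max_of_le_right ?_⟩
  rw [EuclideanSpace.norm_eq]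
  refine Real.sqrt_le_sqrt (Finset.sum_le_sum fun i _ => ?_)
  exact pow_le_pow_left₀ (norm_nonneg _) (hM i x hx) 2

end

end HType

end

theorem theorem1p2 {m k : ℕ} (H : HType.HeisenbergType m k) (p : ℝ) (hp : 1 < p)
    (Ω : Set (HType.Pt m k)) (hΩ : HType.IsSmoothDomain Ω)
    (f : HType.Pt m k → ℝ) (hf : HType.IsWeakSolution H p Ω f)
    (c : ℝ) (hc : 0 ≤ c) (hbc : HType.BoundaryConditions H Ω f c)
    (α : ℝ) (hα : α ∈ Set.Ioo (0 : ℝ) 1) (hreg : HType.IsGamma2 H α Ω f)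
    (hgrad : HType.RGradNonvanishingOnBoundary H Ω f) :
    0 < c ∧ MeasureTheory.IntegrableOn (HType.P H p f) Ω ∧
      ∫ x in Ω, HType.P H p f x = c ^ p * ∫ x in Ω, ‖x.1‖ ^ p := by
  have hO := hΩ.isOpen
  have hb := hΩ.isBounded
  have hC := hreg.contDiffOn hα.1 hO
  obtain ⟨M, hfM, hgM⟩ := hreg.exists_bound
  have hgC := (HType.continuousOn_hgrad H hO hC).norm
  have hweak := hf.isWeakC1Solution hp hO hb hC
  have hdecay : HType.VanishesAtBoundary Ω f :=
    HType.vanishesAtBoundary_of_ae hO hb hC.continuousOn fun ε hε => by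
      obtain ⟨O, h1, h2, h3⟩ := hbc ε hε
      exact ⟨O, h1, h2, h3.mono fun x hx hxO => (hx hxO).2⟩
  have hgdecay : HType.VanishesAtBoundary Ω fun x => ‖HType.hgrad H f x‖ - c * ‖x.1‖ :=
    HType.vanishesAtBoundary_of_ae hO hb
      (hgC.sub (continuous_const.mul (continuous_norm.comp continuous_fst)).continuousOn)
      fun ε hε => by
        obtain ⟨O, h1, h2, h3⟩ := hbc ε hε
        exact ⟨O, h1, h2, h3.mono fun x hx hxO => (hx hxO).1⟩
  have hf0 := HType.nonneg_of_isWeakC1Solution hp hO hC hweak hdecay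
  obtain ⟨hint, hP, hPc⟩ := HType.integral_P_eq hO hb hp hC hweak
    (hf.integral_norm_hgrad_rpow hp hO hb hC) hgrad hfM hgM hf0
    (HType.exists_compact_pos hO hb hC hf0 hgrad) hdecay hc hgdecay
  -- If `c = 0`, the two expressions for `∫ P` show that a positive multiple of `∫ |∇_H f|^p` is
  -- zero.
  refine ⟨hc.lt_of_ne fun h0 => ?_, hint, hPc⟩
  have hi : IntegrableOn (fun x => ‖HType.hgrad H f x‖ ^ p) Ω :=
    HType.integrableOn_of_continuousOn_of_bounded hO hb
      (hgC.rpow_const fun _ _ => Or.inr (by linarith)) (M := M ^ p) fun x hx => by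
        rw [abs_of_nonneg (by positivity)]
        exact Real.rpow_le_rpow (norm_nonneg _) (hgM x hx) (by linarith)
  rw [hPc, ← h0, Real.zero_rpow (by linarith), zero_mul] at hP
  have hQ : 0 ≤ HType.homDim m k := by rw [HType.homDim_eq]; positivity
  have hp1 : 0 < p - 1 := by linarith
  exact (mul_ne_zero (by positivity) (hweak.integral_norm_hgrad_rpow_ne_zero hp hO
    hΩ.isConnected.nonempty hi)) hP.symm
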